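/- Let $\mathcal{A}$ be a real arrangement of linear hyperplanes, i.e. a finite set of linear subspaces of codimension one in $\mathbb{R}^d$. Its \emph{chambers} are the connected components of $\mathbb{R}^d\setminus\bigcup\mathcal{A}$. For chambers $C,C'$ let $S(C,C')$ be the set of all $H\in\mathcal{A}$ that meet a segment joining a point of $C$ with a point of $C'$ (this does not depend on the points); $C$ and $C'$ are \emph{adjacent} if $|S(C,C')|=1$. For a base chamber $C_0$, the \emph{poset of regions} $\mathcal{P}_{C_0}(\mathcal{A})$ is the set of chambers ordered by $C_1\le_{C_0} C_2 \iff S(C_0,C_1)\subseteq S(C_0,C_2)$. The arrangement satisfies the \emph{strong lattice property} if $\mathcal{P}_{C_0}(\mathcal{A})$ is a lattice for every chamber $C_0$. It is \emph{simplicial} if the closure of every chamber is a cone over a simplex, i.e. the set of nonnegative linear combinations of linearly independent vectors (taken modulo $\bigcap_{H\in\mathcal{A}}H$ if this intersection is not $0$). A \emph{positive path} is a directed path (possibly of length $0$) in the arrangement graph, whose vertices are the chambers and which has a pair of opposite oriented edges between any two adjacent chambers. It is \emph{positive minimal} if it has minimal length among the positive paths with the same beginning and end. Let $\sim$ be the smallest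 equivalence relation on positive paths, compatible with concatenation, that identifies any two positive minimal paths with the same beginning and end, and write $(C'\to C)$ for the class of the positive minimal paths from $C'$ to $C$. The arrangement satisfies \emph{property D} if for every positive path $\gamma$ (starting at any chamber, and ending, say, at $C$) there is a chamber $C_\gamma$ such that for every chamber $C'$: one can write $\gamma\sim\gamma'(C'\to C)$ for some positive path $\gamma'$ if and only if $C'\le C_\gamma$ in $\mathcal{P}_C(\mathcal{A})$. \textbf{Theorem.} If $\mathcal{A}$ satisfies property D, then it satisfies the strong lattice property and is simplicial. Moreover, $\mathcal{A}$ satisfies property D if and only if it is simplicial. -/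

import Mathlib

/-- A real arrangement of linear hyperplanes: a finite set of linear subspaces of codimension one
in `ℝ^d`. -/
structure RealArrangement (d : ℕ) where
  hyperplanes : Finset (Submodule ℝ (EuclideanSpace ℝ (Fin d)))
  codim_one : ∀ H ∈ hyperplanes, Module.finrank ℝ (EuclideanSpace ℝ (Fin d) ⧸ H) = 1

namespace RealArrangement

variable {d : ℕ}

/-- The complement of the arrangement in `ℝ^d`. -/
def complement (A : RealArrangement d) : Set (EuclideanSpace ℝ (Fin d)) :=
  {x | ∀ H ∈ A.hyperplanes, x ∉ H}

/-- The chambers: the connected components of the complement. -/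
def Chamber (A : RealArrangement d) : Type :=
  {C : Set (EuclideanSpace ℝ (Fin d)) //
    ∃ x ∈ A.complement, C = connectedComponentIn A.complement x}

/-- The set of points of a chamber. -/
def Chamber.carrier {A : RealArrangement d} (C : A.Chamber) : Set (EuclideanSpace ℝ (Fin d)) :=
  C.1

/-- `A.sep C C'` is the set of the hyperplanes of the arrangement that separate `C` from `C'`: those
that meet the segments joining a point of `C` with a point of `C'`. It does not matter which points
are taken, see `RealArrangement.mem_sep_iff`. -/
def sep (A : RealArrangement d) (C C' : A.Chamber) :
    Set (Submodule ℝ (EuclideanSpace ℝ (Fin d))) :=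
  {H | H ∈ A.hyperplanes ∧
    ∀ x ∈ C.carrier, ∀ y ∈ C'.carrier, (segment ℝ x y ∩ (H : Set _)).Nonempty}

theorem Chamber.nonempty {A : RealArrangement d} (C : A.Chamber) : C.carrier.Nonempty := by
  obtain ⟨C, x, hx, rfl⟩ := C
  exact ⟨x, mem_connectedComponentIn hx⟩

theorem Chamber.subset_complement {A : RealArrangement d} (C : A.Chamber) :
    C.carrier ⊆ A.complement := by
  obtain ⟨C, x, hx, rfl⟩ := C
  exact connectedComponentIn_subset _ _

theorem Chamber.isPreconnected {A : RealArrangement d} (C : A.Chamber) :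
    IsPreconnected C.carrier := by
  obtain ⟨C, x, hx, rfl⟩ := C
  exact isPreconnected_connectedComponentIn

/-- Two chambers that contain the two ends of a connected subset of the complement coincide. -/
theorem Chamber.eq_of_isPreconnected {A : RealArrangement d} {C C' : A.Chamber}
    {s : Set (EuclideanSpace ℝ (Fin d))} (hs : IsPreconnected s) (hsA : s ⊆ A.complement)
    {x y : EuclideanSpace ℝ (Fin d)} (hxs : x ∈ s) (hys : y ∈ s)
    (hx : x ∈ C.carrier) (hy : y ∈ C'.carrier) : C = C' := by
  obtain ⟨C, u, hu, rfl⟩ := C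
  obtain ⟨C', v, hv, rfl⟩ := C'
  apply Subtype.ext
  change connectedComponentIn A.complement u = connectedComponentIn A.complement v
  rw [connectedComponentIn_eq (show x ∈ connectedComponentIn A.complement u from hx),
    connectedComponentIn_eq (show y ∈ connectedComponentIn A.complement v from hy)]
  exact connectedComponentIn_eq (hs.subset_connectedComponentIn hxs hsA hys)

/-- Every hyperplane of the arrangement is the kernel of a linear form. -/
theorem exists_form (A : RealArrangement d) {H : Submodule ℝ (EuclideanSpace ℝ (Fin d))}
    (hH : H ∈ A.hyperplanes) :
    ∃ f : EuclideanSpace ℝ (Fin d) →ₗ[ℝ] ℝ, ∀ x, x ∈ H ↔ f x = 0 := by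
  have h1 : Module.finrank ℝ (EuclideanSpace ℝ (Fin d) ⧸ H) = Module.finrank ℝ ℝ := by
    rw [A.codim_one H hH, Module.finrank_self]
  let e := LinearEquiv.ofFinrankEq (R := ℝ) _ _ h1
  refine ⟨e.toLinearMap ∘ₗ H.mkQ, fun x => ?_⟩
  simp

/-- A linear form that has no zero on a preconnected set has a constant sign there. -/
theorem mul_pos_of_isPreconnected {s : Set (EuclideanSpace ℝ (Fin d))} (hs : IsPreconnected s)
    (f : EuclideanSpace ℝ (Fin d) →ₗ[ℝ] ℝ) (hf : ∀ x ∈ s, f x ≠ 0)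
    {x y : EuclideanSpace ℝ (Fin d)} (hx : x ∈ s) (hy : y ∈ s) : 0 < f x * f y := by
  have hc : ContinuousOn f s := f.continuous_of_finiteDimensional.continuousOn
  by_contra hn
  have h0 : (0 : ℝ) ∈ f '' s := by
    rcases lt_or_gt_of_ne (hf x hx) with h | h <;> rcases lt_or_gt_of_ne (hf y hy) with h' | h'
    · exact absurd (mul_pos_of_neg_of_neg h h') hn
    · exact hs.intermediate_value hx hy hc ⟨h.le, h'.le⟩
    · exact hs.intermediate_value hy hx hc ⟨h'.le, h.le⟩
    · exact absurd (mul_pos h h') hn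
  obtain ⟨z, hz, hz0⟩ := h0
  exact hf z hz hz0

/-- A segment meets the zero set of a linear form exactly when the form does not have the same
strict sign at the two ends. -/
theorem segment_inter_nonempty_iff (f : EuclideanSpace ℝ (Fin d) →ₗ[ℝ] ℝ)
    {x y : EuclideanSpace ℝ (Fin d)} :
    (∃ z ∈ segment ℝ x y, f z = 0) ↔ ¬ 0 < f x * f y := by
  constructor
  · rintro ⟨z, ⟨a, b, ha, hb, hab, rfl⟩, hz⟩ hpos
    simp only [map_add, map_smul, smul_eq_mul] at hz
    have h1 : a * (f x * f x) + b * (f x * f y) = 0 := by linear_combination f x * hz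
    have h2 : 0 < f x * f x := by
      have : f x ≠ 0 := by rintro h; simp [h] at hpos
      exact mul_self_pos.2 this
    rcases ha.eq_or_lt with rfl | ha'
    · have : b = 1 := by linarith
      subst this
      linarith
    · have := mul_pos ha' h2
      have := mul_nonneg hb hpos.le
      linarith
  · intro h
    by_contra hn
    push Not at hn
    exact h (mul_pos_of_isPreconnected (convex_segment x y).isPreconnected f hn
      (left_mem_segment ℝ x y) (right_mem_segment ℝ x y))

/-- Whether a hyperplane separates two chambers can be read off from any two of their points. -/
theorem mem_sep_iff (A : RealArrangement d) {C C' : A.Chamber}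
    {H : Submodule ℝ (EuclideanSpace ℝ (Fin d))} (hH : H ∈ A.hyperplanes)
    {x y : EuclideanSpace ℝ (Fin d)} (hx : x ∈ C.carrier) (hy : y ∈ C'.carrier) :
    H ∈ A.sep C C' ↔ (segment ℝ x y ∩ (H : Set _)).Nonempty := by
  refine ⟨fun h => h.2 x hx y hy, fun h => ⟨hH, fun x' hx' y' hy' => ?_⟩⟩
  obtain ⟨f, hf⟩ := A.exists_form hH
  have hz : ∀ D : A.Chamber, ∀ u ∈ D.carrier, f u ≠ 0 := fun D u hu h0 =>
    D.subset_complement hu H hH ((hf u).2 h0)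
  have key : ∀ u v, (segment ℝ u v ∩ (H : Set _)).Nonempty ↔ ¬ 0 < f u * f v := by
    intro u v
    rw [← segment_inter_nonempty_iff f]
    constructor
    · rintro ⟨z, h1, h2⟩
      exact ⟨z, h1, (hf z).1 h2⟩
    · rintro ⟨z, h1, h2⟩
      exact ⟨z, h1, (hf z).2 h2⟩
  rw [key] at h ⊢
  have h1 := mul_pos_of_isPreconnected C.isPreconnected f (hz C) hx hx'
  have h2 := mul_pos_of_isPreconnected C'.isPreconnected f (hz C') hy hy'
  intro h3
  apply h
  have h4 : 0 < (f x * f y) * (f x' * f y') := by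
    have := mul_pos h1 h2
    linarith [this, show (f x * f y) * (f x' * f y') = f x * f x' * (f y * f y') by ring]
  exact (pos_iff_pos_of_mul_pos h4).2 h3

theorem sep_comm (A : RealArrangement d) (C C' : A.Chamber) : A.sep C C' = A.sep C' C := by
  ext H
  constructor
  · rintro ⟨hH, h⟩
    exact ⟨hH, fun x hx y hy => by rw [segment_symm]; exact h y hy x hx⟩
  · rintro ⟨hH, h⟩
    exact ⟨hH, fun x hx y hy => by rw [segment_symm]; exact h y hy x hx⟩

theorem sep_self (A : RealArrangement d) (C : A.Chamber) : A.sep C C = ∅ := by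
  ext H
  simp only [Set.mem_empty_iff_false, iff_false]
  rintro ⟨hH, h⟩
  obtain ⟨x, hx⟩ := C.nonempty
  obtain ⟨z, hz, hzH⟩ := h x hx x hx
  rw [segment_same, Set.mem_singleton_iff] at hz
  subst hz
  exact C.subset_complement hx H hH hzH

/-- A chamber is determined by the hyperplanes that separate it from a fixed chamber. -/
theorem sep_injective (A : RealArrangement d) {C₀ C C' : A.Chamber}
    (h : A.sep C₀ C = A.sep C₀ C') : C = C' := by
  obtain ⟨p, hp⟩ := C₀.nonempty
  obtain ⟨x, hx⟩ := C.nonempty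
  obtain ⟨y, hy⟩ := C'.nonempty
  refine Chamber.eq_of_isPreconnected (convex_segment x y).isPreconnected ?_
    (left_mem_segment ℝ x y) (right_mem_segment ℝ x y) hx hy
  intro z hz H hH hzH
  obtain ⟨f, hf⟩ := A.exists_form hH
  have key : ∀ u v, (segment ℝ u v ∩ (H : Set _)).Nonempty ↔ ¬ 0 < f u * f v := by
    intro u v
    rw [← segment_inter_nonempty_iff f]
    constructor
    · rintro ⟨z, h1, h2⟩
      exact ⟨z, h1, (hf z).1 h2⟩
    · rintro ⟨z, h1, h2⟩
      exact ⟨z, h1, (hf z).2 h2⟩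
  have hne : ∀ D : A.Chamber, ∀ u ∈ D.carrier, f u ≠ 0 := fun D u hu h0 =>
    D.subset_complement hu H hH ((hf u).2 h0)
  have hiff : 0 < f p * f x ↔ 0 < f p * f y := by
    have h1 := A.mem_sep_iff hH hp hx
    have h2 := A.mem_sep_iff hH hp hy
    rw [h, h2, key, key, not_iff_not] at h1
    exact h1.symm
  refine (key x y).1 ⟨z, hz, hzH⟩ ?_
  rcases lt_or_gt_of_ne (hne _ p hp) with h1 | h1 <;>
    rcases lt_or_gt_of_ne (hne _ x hx) with h2 | h2 <;>
    rcases lt_or_gt_of_ne (hne _ y hy) with h3 | h3 <;>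
    first
    | exact mul_pos h2 h3
    | exact mul_pos_of_neg_of_neg h2 h3
    | (exfalso; have := mul_pos_of_neg_of_neg h1 h2; have := mul_neg_of_neg_of_pos h1 h3
       linarith [hiff.1 (by assumption)])
    | (exfalso; have := mul_pos_of_neg_of_neg h1 h3; have := mul_neg_of_neg_of_pos h1 h2
       linarith [hiff.2 (by assumption)])
    | (exfalso; have := mul_pos h1 h2; have := mul_neg_of_pos_of_neg h1 h3
       linarith [hiff.1 (by assumption)])
    | (exfalso; have := mul_pos h1 h3; have := mul_neg_of_pos_of_neg h1 h2
       linarith [hiff.2 (by assumption)])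

/-- The poset of regions `P_{C₀}(A)`: the set of all chambers, ordered with base chamber `C₀`. -/
def Regions (A : RealArrangement d) (_C₀ : A.Chamber) : Type := A.Chamber

/-- `C₁ ≤ C₂` in the poset of regions based at `C₀` if and only if every hyperplane that separates
`C₀` from `C₁` separates `C₀` from `C₂`. -/
instance (A : RealArrangement d) (C₀ : A.Chamber) : PartialOrder (A.Regions C₀) where
  le C₁ C₂ := A.sep C₀ C₁ ⊆ A.sep C₀ C₂
  le_refl _ := subset_rfl
  le_trans _ _ _ h h' := h.trans h'
  le_antisymm _ _ h h' := A.sep_injective (h.antisymm h')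

/-- The strong lattice property: for every base chamber, the poset of regions is a lattice, that is,
any two elements have a join and a meet. -/
def StrongLattice (A : RealArrangement d) : Prop :=
  ∀ C₀ : A.Chamber, ∀ p q : A.Regions C₀,
    (∃ j : A.Regions C₀, IsLUB {p, q} j) ∧ (∃ m : A.Regions C₀, IsGLB {p, q} m)

/-- The common intersection of the hyperplanes. -/
def center (A : RealArrangement d) : Submodule ℝ (EuclideanSpace ℝ (Fin d)) :=
  ⨅ H ∈ A.hyperplanes, H

/-- The arrangement is simplicial: the closure of every chamber is a cone over a simplex, that is,
the set of the nonnegative combinations of linearly independent vectors. If the hyperplanes have a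
nonzero common intersection, then this is understood modulo this common intersection. -/
def Simplicial (A : RealArrangement d) : Prop :=
  ∀ C : A.Chamber, ∃ σ : PointedCone ℝ (EuclideanSpace ℝ (Fin d) ⧸ A.center),
    σ.IsSimplicial ∧ closure C.carrier = A.center.mkQ ⁻¹' (σ : Set _)

/-- The graph on the chambers in which two chambers are joined by an edge if and only if they are
adjacent, that is, separated by exactly one hyperplane. Since each edge stands for a pair of opposite
oriented edges of the arrangement graph, the walks in it are the directed paths on the arrangement
graph (the positive paths). -/
def graph (A : RealArrangement d) : SimpleGraph A.Chamber where
  Adj C C' := ∃ H, A.sep C C' = {H}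
  symm := ⟨fun C C' ⟨H, h⟩ => ⟨H, by rw [A.sep_comm, h]⟩⟩
  loopless := ⟨fun C ⟨H, h⟩ => Set.singleton_ne_empty H (by rw [← h, A.sep_self])⟩

/-- Positive paths from `C` to `C'`. -/
abbrev PosPath (A : RealArrangement d) (C C' : A.Chamber) : Type := A.graph.Walk C C'

/-- A positive minimal path: a positive path of minimal length between its ends. -/
def PosPath.IsMinimal {A : RealArrangement d} {C C' : A.Chamber} (p : A.PosPath C C') : Prop :=
  ∀ q : A.PosPath C C', p.length ≤ q.length

/-- Equality of the classes in the category of positive paths, the quotient of the free category on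
the arrangement graph by the relation generated by identifying any two positive minimal paths that
have the same beginning and the same end. -/
inductive PosPath.Equiv {A : RealArrangement d} :
    {C C' : A.Chamber} → A.PosPath C C' → A.PosPath C C' → Prop
  | minimal {C C' : A.Chamber} (p q : A.PosPath C C') :
      p.IsMinimal → q.IsMinimal → PosPath.Equiv p q
  | refl {C C' : A.Chamber} (p : A.PosPath C C') : PosPath.Equiv p p
  | symm {C C' : A.Chamber} {p q : A.PosPath C C'} : PosPath.Equiv p q → PosPath.Equiv q p
  | trans {C C' : A.Chamber} {p q r : A.PosPath C C'} :
      PosPath.Equiv p q → PosPath.Equiv q r → PosPath.Equiv p r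
  | append {C C' C'' : A.Chamber} {p q : A.PosPath C C'} {r s : A.PosPath C' C''} :
      PosPath.Equiv p q → PosPath.Equiv r s → PosPath.Equiv (p.append r) (q.append s)

/-- The class of `γ` ends with the positive minimal path from `C'` to `C`: it is the class of
`γ' (C' → C)` for some positive path `γ'`. -/
def PosPath.EndsWith {A : RealArrangement d} {B C : A.Chamber} (γ : A.PosPath B C)
    (C' : A.Chamber) : Prop :=
  ∃ (γ' : A.PosPath B C') (μ : A.PosPath C' C), μ.IsMinimal ∧ γ.Equiv (γ'.append μ)

/-- Property D: for all chambers `B`, `C` and every positive path `γ` from `B` to `C` there is a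
chamber `K` such that `γ` ends with `C' → C` if and only if `C' ≤ K` in the poset of regions
based at `C`. -/
def PropertyD (A : RealArrangement d) : Prop :=
  ∀ (B C : A.Chamber) (γ : A.PosPath B C), ∃ K : A.Regions C,
    ∀ C' : A.Regions C, γ.EndsWith C' ↔ C' ≤ K

end RealArrangement

/-!
Every step goes through the poset of regions: property D is equivalent to the strong lattice
property, which is equivalent to simpliciality. A chamber is determined by the signs that linear
forms of the hyperplanes (`formAt`) take on it, and `sep C E` is the symmetric difference of
`sep C D` and `sep D E`; a path is positive minimal if and only if it crosses each separating
hyperplane once (`PosPath.isMinimal_iff`, `PosPath.IsMinimal.crossings_eq`).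

*Property D gives meets* (`PropertyD.exists_isMeet`). For chambers `X`, `Y` and a base `B`, let `C`
be opposite to `Y`, and let `K` be the chamber assigned to the path `(X → B)(B → C)`. The number of
crossings of each hyperplane is an invariant of the class of a path, which shows that `K` lies below
`X` and `Y`; and every common lower bound `U` gives a factorization of the path that ends with
`(U → C)`. Passing to opposite chambers exchanges meets and joins.

*The strong lattice property gives property D* (`StrongLattice.propertyD`). The greatest final
factor of a product `(K → D)(D → C)` of two positive minimal paths is a meet in the poset of regions
based at `D` (`StrongLattice.lastFactor`). Iterating along a path gives its greatest final factor;
by `StrongLattice.lastFactor_lastFactor` the result depends only on the class of the path.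

*The strong lattice property implies simpliciality* (`StrongLattice.simplicial`). Given a linear
relation between the forms of the walls of `C`, the join of the chambers across those walls whose
coefficient is positive lies across these walls and no others, so that no term of the relation is
positive on it, and every nonzero coefficient gives a negative term
(`StrongLattice.linearIndependent_walls`). As a chamber is cut out by its walls, a dual family of
vectors generates its closure modulo the center.

*Simpliciality implies the strong lattice property* (`Simplicial.strongLattice`). Any two walls of a
simplicial chamber meet in a face of codimension two, and the chamber opposite across this face is
the join of the two chambers that cover it (`Simplicial.exists_isJoin_of_covers`). In a finite poset
with a least element, joins of pairs that cover a common element propagate to all pairs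
(`Simplicial.exists_isJoin_of_le`).
-/

namespace RealArrangement

variable {d : ℕ} {A : RealArrangement d}

/-! ### Oriented forms and separation -/

theorem exists_formAt (C : A.Chamber) {H : Submodule ℝ (EuclideanSpace ℝ (Fin d))}
    (hH : H ∈ A.hyperplanes) :
    ∃ f : EuclideanSpace ℝ (Fin d) →ₗ[ℝ] ℝ, (∀ x, x ∈ H ↔ f x = 0) ∧ ∀ x ∈ C.carrier, 0 < f x := by
  obtain ⟨f, hf⟩ := A.exists_form hH
  obtain ⟨p, hp⟩ := C.nonempty
  have hne : ∀ x ∈ C.carrier, f x ≠ 0 := fun x hx h0 =>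
    C.subset_complement hx H hH ((hf x).2 h0)
  refine ⟨f p • f, fun x => ?_, fun x hx => ?_⟩
  · simp [hf, hne p hp]
  · exact mul_pos_of_isPreconnected C.isPreconnected f hne hp hx

open Classical in
/-- A linear form whose kernel is the hyperplane `H`, oriented so as to be positive on the chamber
`C`. It is the junk value `0` if `H` does not belong to the arrangement. -/
noncomputable def formAt (C : A.Chamber) (H : Submodule ℝ (EuclideanSpace ℝ (Fin d))) :
    EuclideanSpace ℝ (Fin d) →ₗ[ℝ] ℝ :=
  if hH : H ∈ A.hyperplanes then (exists_formAt C hH).choose else 0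

section

variable {C D E B : A.Chamber} {H : Submodule ℝ (EuclideanSpace ℝ (Fin d))}
  {x y : EuclideanSpace ℝ (Fin d)}

theorem mem_iff_formAt_eq_zero (C : A.Chamber) (hH : H ∈ A.hyperplanes) :
    x ∈ H ↔ formAt C H x = 0 := by
  rw [formAt, dif_pos hH]
  exact (exists_formAt C hH).choose_spec.1 x

theorem formAt_pos (hH : H ∈ A.hyperplanes) (hx : x ∈ C.carrier) : 0 < formAt C H x := by
  rw [formAt, dif_pos hH]
  exact (exists_formAt C hH).choose_spec.2 x hx

theorem formAt_ne_zero (C : A.Chamber) (hH : H ∈ A.hyperplanes) (hx : x ∈ A.complement) :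
    formAt C H x ≠ 0 := fun h => hx H hH ((mem_iff_formAt_eq_zero C hH).2 h)

theorem mem_hyperplanes_of_mem_sep (h : H ∈ A.sep C D) : H ∈ A.hyperplanes := h.1

theorem mem_sep_iff_mul_neg (B : A.Chamber) (hH : H ∈ A.hyperplanes) (hx : x ∈ C.carrier)
    (hy : y ∈ D.carrier) : H ∈ A.sep C D ↔ formAt B H x * formAt B H y < 0 := by
  have h1 : formAt B H x * formAt B H y ≠ 0 :=
    mul_ne_zero (formAt_ne_zero B hH (C.subset_complement hx))
      (formAt_ne_zero B hH (D.subset_complement hy))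
  rw [A.mem_sep_iff hH hx hy]
  constructor
  · rintro ⟨z, h2, h3⟩
    exact lt_of_le_of_ne (not_lt.1 ((segment_inter_nonempty_iff _).1
      ⟨z, h2, (mem_iff_formAt_eq_zero B hH).1 h3⟩)) h1
  · intro h
    obtain ⟨z, h2, h3⟩ := (segment_inter_nonempty_iff (formAt B H)).2 h.not_gt
    exact ⟨z, h2, (mem_iff_formAt_eq_zero B hH).2 h3⟩

theorem mem_sep_iff_formAt_neg (hH : H ∈ A.hyperplanes) (hy : y ∈ D.carrier) :
    H ∈ A.sep C D ↔ formAt C H y < 0 := by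
  obtain ⟨x, hx⟩ := C.nonempty
  rw [mem_sep_iff_mul_neg C hH hx hy, mul_neg_iff]
  have := formAt_pos hH hx
  constructor
  · rintro (h | h)
    · exact h.2
    · exact absurd h.1 this.not_gt
  · exact fun h => Or.inl ⟨this, h⟩

theorem formAt_pos_of_notMem_sep (hH : H ∈ A.hyperplanes) (hy : y ∈ D.carrier)
    (h : H ∉ A.sep C D) : 0 < formAt C H y := by
  rw [mem_sep_iff_formAt_neg hH hy, not_lt] at h
  exact lt_of_le_of_ne h (formAt_ne_zero C hH (D.subset_complement hy)).symm

/-- The set of separating hyperplanes is additive modulo `2`: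
`S(C, E)` is the symmetric difference of `S(C, D)` and `S(D, E)`. -/
theorem mem_sep_triangle (C D E : A.Chamber) (H : Submodule ℝ (EuclideanSpace ℝ (Fin d))) :
    H ∈ A.sep C E ↔ (H ∈ A.sep C D ∧ H ∉ A.sep D E) ∨ (H ∉ A.sep C D ∧ H ∈ A.sep D E) := by
  by_cases hH : H ∈ A.hyperplanes
  · obtain ⟨x, hx⟩ := C.nonempty
    obtain ⟨y, hy⟩ := D.nonempty
    obtain ⟨z, hz⟩ := E.nonempty
    rw [mem_sep_iff_formAt_neg hH hy, mem_sep_iff_formAt_neg hH hz, mem_sep_iff_mul_neg C hH hy hz]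
    have h1 := formAt_ne_zero C hH (D.subset_complement hy)
    have h2 := formAt_ne_zero C hH (E.subset_complement hz)
    rcases lt_or_gt_of_ne h1 with h1 | h1 <;> rcases lt_or_gt_of_ne h2 with h2 | h2 <;>
      simp [h1, h2, mul_neg_iff, h1.not_gt, h2.not_gt]
  · simp [mt mem_hyperplanes_of_mem_sep hH]

/-- If no hyperplane is crossed both on the way from `C` to `D` and on the way from `D` to `E`, then
the two sets of separating hyperplanes add up. -/
theorem sep_eq_union (h : Disjoint (A.sep C D) (A.sep D E)) :
    A.sep C E = A.sep C D ∪ A.sep D E := by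
  ext H
  have h1 := mem_sep_triangle C D E H
  have h2 : H ∈ A.sep C D → H ∉ A.sep D E := fun h3 => Set.disjoint_left.1 h h3
  rw [Set.mem_union]
  tauto

theorem disjoint_sep_of_subset (h : A.sep C D ⊆ A.sep C E) :
    Disjoint (A.sep C D) (A.sep D E) := by
  rw [Set.disjoint_left]
  intro H hH
  have h1 := (mem_sep_triangle C D E H).1 (h hH)
  tauto

theorem sep_finite (C D : A.Chamber) : (A.sep C D).Finite :=
  A.hyperplanes.finite_toSet.subset fun _ h => h.1

theorem eq_of_sep_eq_empty (h : A.sep C D = ∅) : C = D :=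
  A.sep_injective (C₀ := C) (by rw [h, A.sep_self])

theorem exists_mem_chamber (hx : x ∈ A.complement) : ∃ C : A.Chamber, x ∈ C.carrier :=
  ⟨⟨_, x, hx, rfl⟩, mem_connectedComponentIn hx⟩

theorem mem_carrier_iff : x ∈ C.carrier ↔ ∀ H ∈ A.hyperplanes, 0 < formAt C H x := by
  refine ⟨fun hx H hH => formAt_pos hH hx, fun h => ?_⟩
  obtain ⟨D, hD⟩ := exists_mem_chamber (A := A) (x := x)
    fun H hH hx => (h H hH).ne' ((mem_iff_formAt_eq_zero C hH).1 hx)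
  rwa [eq_of_sep_eq_empty (C := C) (D := D)]
  refine Set.eq_empty_of_forall_notMem fun H hH => ?_
  exact (h H hH.1).not_gt ((mem_sep_iff_formAt_neg hH.1 hD).1 hH)

/-- Every chamber has an opposite chamber. -/
theorem exists_opposite (C : A.Chamber) :
    ∃ D : A.Chamber, ∀ B, ∀ H ∈ A.hyperplanes, H ∈ A.sep B D ↔ H ∉ A.sep B C := by
  obtain ⟨x, hx⟩ := C.nonempty
  obtain ⟨D, hD⟩ := exists_mem_chamber (A := A) (x := -x)
    fun H hH h => C.subset_complement hx H hH (by simpa using h)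
  refine ⟨D, fun B H hH => ?_⟩
  rw [mem_sep_iff_formAt_neg hH hx, mem_sep_iff_formAt_neg hH hD, map_neg, neg_lt_zero, not_lt]
  exact ⟨le_of_lt, fun h => lt_of_le_of_ne h (formAt_ne_zero B hH (C.subset_complement hx)).symm⟩

/-- The chamber opposite to `C`. -/
noncomputable def opposite (C : A.Chamber) : A.Chamber := (exists_opposite C).choose

theorem mem_sep_opposite (B C : A.Chamber) :
    H ∈ A.sep B (opposite C) ↔ H ∈ A.hyperplanes ∧ H ∉ A.sep B C :=
  ⟨fun h => ⟨h.1, ((exists_opposite C).choose_spec B H h.1).1 h⟩,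
    fun h => ((exists_opposite C).choose_spec B H h.1).2 h.2⟩

theorem opposite_opposite (C : A.Chamber) : opposite (opposite C) = C := by
  refine A.sep_injective (C₀ := C) ?_
  ext H
  rw [mem_sep_opposite, mem_sep_opposite]
  simp only [A.sep_self]
  simp

/-! ### Walls -/

/-- A chamber contains a neighbourhood, along every line, of each of its points. -/
theorem eventually_add_smul_mem (hx : x ∈ C.carrier) (v : EuclideanSpace ℝ (Fin d)) :
    ∀ᶠ t : ℝ in nhds 0, x + t • v ∈ C.carrier := by
  simp only [mem_carrier_iff]
  rw [Filter.eventually_all_finset]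
  intro H hH
  have h1 : Filter.Tendsto (fun t : ℝ => formAt C H (x + t • v)) (nhds 0)
      (nhds (formAt C H x)) := by
    have : Continuous fun t : ℝ => formAt C H (x + t • v) := by
      simp only [map_add, map_smul, smul_eq_mul]
      fun_prop
    simpa using this.tendsto 0
  exact h1.eventually_const_lt (formAt_pos hH hx)

/-- A line through a point of the complement meets the arrangement in finitely many points. -/
theorem finite_setOf_add_smul_notMem_complement (hx : x ∈ A.complement)
    (v : EuclideanSpace ℝ (Fin d)) : {t : ℝ | x + t • v ∉ A.complement}.Finite := by
  have h1 : {t : ℝ | x + t • v ∉ A.complement} ⊆ ⋃ H ∈ A.hyperplanes, {t : ℝ | x + t • v ∈ H} := by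
    intro t ht
    simp only [complement, Set.mem_ofPred_eq] at ht
    push Not at ht
    simpa using ht
  refine (A.hyperplanes.finite_toSet.biUnion fun H hH => Set.Subsingleton.finite ?_).subset h1
  intro s hs t ht
  by_contra hst
  refine hx H hH ?_
  have h2 : (s - t) • v ∈ H := by
    have := H.sub_mem hs ht
    rwa [add_sub_add_left_eq_sub, ← sub_smul] at this
  have h3 : v ∈ H := (H.smul_mem_iff (sub_ne_zero.2 hst)).1 h2
  exact (H.add_mem_iff_left (H.smul_mem s h3)).1 hs

/-- If the segment from `x ∈ C` to `y ∈ D` crosses `H₁` before `H₂`, then it has a point between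
the two in some chamber. -/
theorem exists_chamber_between (hx : x ∈ C.carrier) (hy : y ∈ D.carrier)
    {H₁ H₂ : Submodule ℝ (EuclideanSpace ℝ (Fin d))} (h₁ : H₁ ∈ A.sep C D) (h₂ : H₂ ∈ A.sep C D)
    (hlt : formAt C H₂ x * formAt C H₁ y < formAt C H₁ x * formAt C H₂ y) :
    ∃ E : A.Chamber, A.sep C E ⊆ A.sep C D ∧ H₁ ∈ A.sep C E ∧ H₂ ∉ A.sep C E := by
  have p1 := formAt_pos h₁.1 hx
  have p2 := formAt_pos h₂.1 hx
  have n1 := (mem_sep_iff_formAt_neg h₁.1 hy).1 h₁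
  have n2 := (mem_sep_iff_formAt_neg h₂.1 hy).1 h₂
  have hval : ∀ H (t : ℝ), formAt C H (x + t • (y - x)) =
      formAt C H x + t * (formAt C H y - formAt C H x) := fun H t => by simp
  have ht : formAt C H₁ x / (formAt C H₁ x - formAt C H₁ y) <
      formAt C H₂ x / (formAt C H₂ x - formAt C H₂ y) := by
    rw [div_lt_div_iff₀ (by linarith) (by linarith)]
    linarith
  obtain ⟨t, ⟨ht1, ht2⟩, ht⟩ := ((Set.Ioo_infinite ht).sdiff
    (finite_setOf_add_smul_notMem_complement (C.subset_complement hx) (y - x))).nonempty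
  rw [Set.mem_ofPred_eq, not_not] at ht
  rw [div_lt_iff₀ (by linarith)] at ht1
  rw [lt_div_iff₀ (by linarith)] at ht2
  have t0 : 0 < t := by
    by_contra h
    nlinarith
  have t1 : t < 1 := by
    by_contra h
    nlinarith
  obtain ⟨E, hE⟩ := exists_mem_chamber ht
  refine ⟨E, fun H hH => ?_, ?_, ?_⟩
  · have hH' := hH.1
    rw [mem_sep_iff_formAt_neg hH' hE, hval] at hH
    rw [mem_sep_iff_formAt_neg hH' hy]
    have := formAt_pos hH' hx
    by_contra h
    nlinarith
  · rw [mem_sep_iff_formAt_neg h₁.1 hE, hval]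
    linarith
  · rw [mem_sep_iff_formAt_neg h₂.1 hE, hval]
    linarith

/-- Two hyperplanes that separate `C` from `D` are crossed one after the other on the way to `D`
from a suitable point of `C`. -/
theorem exists_sep_ssubset {H₁ H₂ : Submodule ℝ (EuclideanSpace ℝ (Fin d))}
    (h₁ : H₁ ∈ A.sep C D) (h₂ : H₂ ∈ A.sep C D) (hne : H₁ ≠ H₂) :
    ∃ E : A.Chamber, A.sep C E ⊂ A.sep C D ∧ (A.sep C E).Nonempty := by
  obtain ⟨x, hx⟩ := C.nonempty
  obtain ⟨y, hy⟩ := D.nonempty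
  have n1 := (mem_sep_iff_formAt_neg h₁.1 hy).1 h₁
  have n2 := (mem_sep_iff_formAt_neg h₂.1 hy).1 h₂
  -- The segment from `x` to `y` meets `H₁` and `H₂` at the same point exactly when `g x = 0`.
  let g := formAt C H₂ y • formAt C H₁ - formAt C H₁ y • formAt C H₂
  have hg : ∀ u, g u = formAt C H₂ y * formAt C H₁ u - formAt C H₁ y * formAt C H₂ u :=
    fun u => by simp [g]
  obtain ⟨v, hv⟩ : ∃ v, g v ≠ 0 := by
    by_contra! h
    refine hne (Submodule.ext fun u => ?_)
    rw [mem_iff_formAt_eq_zero C h₁.1, mem_iff_formAt_eq_zero C h₂.1]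
    have h3 := h u
    rw [hg, sub_eq_zero] at h3
    constructor
    · intro h4
      simpa [h4, n1.ne] using h3.symm
    · intro h4
      simpa [h4, n2.ne] using h3
  obtain ⟨x', hx', hgx⟩ : ∃ x' ∈ C.carrier, g x' ≠ 0 := by
    by_cases h0 : g x = 0
    · obtain ⟨t, h3, h4⟩ := (((eventually_add_smul_mem hx v).filter_mono
        nhdsWithin_le_nhds).and (self_mem_nhdsWithin (a := (0 : ℝ)) (s := {0}ᶜ))).exists
      refine ⟨_, h3, ?_⟩
      simpa [h0] using And.intro h4 hv
    · exact ⟨x, hx, h0⟩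
  rw [hg] at hgx
  rcases lt_or_gt_of_ne hgx with h | h
  · obtain ⟨E, h3, h4, h5⟩ := exists_chamber_between hx' hy h₂ h₁ (by linarith)
    exact ⟨E, ⟨h3, fun h6 => h5 (h6 h₁)⟩, H₂, h4⟩
  · obtain ⟨E, h3, h4, h5⟩ := exists_chamber_between hx' hy h₁ h₂ (by linarith)
    exact ⟨E, ⟨h3, fun h6 => h5 (h6 h₂)⟩, H₁, h4⟩

/-- Between two distinct chambers, there is a hyperplane that can be crossed first. -/
theorem exists_sep_eq_singleton (h : C ≠ D) : ∃ E : A.Chamber, ∃ H ∈ A.sep C D, A.sep C E = {H} := by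
  induction hn : (A.sep C D).ncard using Nat.strong_induction_on generalizing D with
  | _ n ih =>
    obtain ⟨H₁, h₁⟩ := Set.nonempty_iff_ne_empty.2 (mt eq_of_sep_eq_empty h)
    by_cases h3 : A.sep C D = {H₁}
    · exact ⟨D, H₁, h₁, h3⟩
    · obtain ⟨H₂, h₂, hne⟩ : ∃ H₂ ∈ A.sep C D, H₂ ≠ H₁ := by
        by_contra! h4
        exact h3 (Set.eq_singleton_iff_unique_mem.2 ⟨h₁, h4⟩)
      obtain ⟨E, h4, h5⟩ := exists_sep_ssubset h₂ h₁ hne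
      obtain ⟨F, H, h6, h7⟩ := ih _ (hn ▸ Set.ncard_lt_ncard h4 (sep_finite C D)) (D := E)
        (by rintro rfl; simp [A.sep_self] at h5) rfl
      exact ⟨F, H, h4.1 h6, h7⟩

/-- The walls of a chamber: the hyperplanes that alone separate it from another chamber. -/
def walls (C : A.Chamber) : Set (Submodule ℝ (EuclideanSpace ℝ (Fin d))) :=
  {H | ∃ D, A.sep C D = {H}}

theorem mem_hyperplanes_of_mem_walls (h : H ∈ walls C) : H ∈ A.hyperplanes := by
  obtain ⟨D, hD⟩ := h
  exact mem_hyperplanes_of_mem_sep (C := C) (D := D) (by rw [hD]; rfl)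

theorem mem_carrier_of_forall_walls (hx : x ∈ A.complement)
    (h : ∀ H ∈ walls C, 0 ≤ formAt C H x) : x ∈ C.carrier := by
  obtain ⟨D, hD⟩ := exists_mem_chamber hx
  by_cases hCD : C = D
  · rwa [hCD]
  · obtain ⟨E, H, h1, h2⟩ := exists_sep_eq_singleton hCD
    exact absurd ((mem_sep_iff_formAt_neg h1.1 hD).1 h1) (h H ⟨E, h2⟩).not_gt

theorem mem_closure_iff : y ∈ closure C.carrier ↔ ∀ H ∈ A.hyperplanes, 0 ≤ formAt C H y := by
  constructor
  · intro hy H hH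
    have hcl : IsClosed {y | 0 ≤ formAt C H y} :=
      isClosed_le continuous_const (formAt C H).continuous_of_finiteDimensional
    exact closure_minimal (fun z hz => (formAt_pos hH hz).le) hcl hy
  · intro h
    obtain ⟨x, hx⟩ := C.nonempty
    have h1 : Filter.Tendsto (fun t : ℝ => y + t • x) (nhdsWithin 0 (Set.Ioi 0)) (nhds y) := by
      have : Continuous fun t : ℝ => y + t • x := by fun_prop
      simpa using (this.tendsto 0).mono_left nhdsWithin_le_nhds
    refine mem_closure_of_tendsto h1 ?_
    filter_upwards [self_mem_nhdsWithin] with t ht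
    rw [mem_carrier_iff]
    intro H hH
    have := mul_pos (Set.mem_Ioi.1 ht) (formAt_pos hH hx)
    have := h H hH
    simp only [map_add, map_smul, smul_eq_mul]
    linarith

/-- A chamber is cut out by its walls. -/
theorem mem_closure_iff_walls : y ∈ closure C.carrier ↔ ∀ H ∈ walls C, 0 ≤ formAt C H y := by
  refine ⟨fun h H hH => mem_closure_iff.1 h H (mem_hyperplanes_of_mem_walls hH), fun h => ?_⟩
  rw [mem_closure_iff]
  intro H hH
  obtain ⟨x, hx⟩ := C.nonempty
  by_contra! hneg
  -- Walk from `y` towards `x`, staying on the negative side of `H`, and off the arrangement.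
  have hpos := formAt_pos hH hx
  have hlt : formAt C H x / (formAt C H x - formAt C H y) < 1 := by
    rw [div_lt_one (by linarith)]
    linarith
  obtain ⟨t, ⟨ht1, ht2⟩, ht⟩ := ((Set.Ioo_infinite hlt).sdiff
    (finite_setOf_add_smul_notMem_complement (C.subset_complement hx) (y - x))).nonempty
  rw [Set.mem_ofPred_eq, not_not] at ht
  rw [div_lt_iff₀ (by linarith)] at ht1
  have t0 : 0 < t := by
    by_contra h
    nlinarith
  have hval : ∀ H (t : ℝ), formAt C H (x + t • (y - x)) =
      formAt C H x + t * (formAt C H y - formAt C H x) := fun H t => by simp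
  have hmem := mem_carrier_of_forall_walls (C := C) ht fun K hK => by
    have := formAt_pos (mem_hyperplanes_of_mem_walls hK) hx
    have := h K hK
    rw [hval]
    nlinarith
  have := formAt_pos hH hmem
  rw [hval] at this
  linarith

theorem mem_center_iff : x ∈ A.center ↔ ∀ H ∈ A.hyperplanes, x ∈ H := by
  simp [center]

/-- The walls of a chamber have the same common intersection as all the hyperplanes. -/
theorem mem_center_iff_walls (C : A.Chamber) : x ∈ A.center ↔ ∀ H ∈ walls C, formAt C H x = 0 := by
  rw [mem_center_iff]
  constructor
  · exact fun h H hH => (mem_iff_formAt_eq_zero C (mem_hyperplanes_of_mem_walls hH)).1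
      (h H (mem_hyperplanes_of_mem_walls hH))
  · intro h H hH
    rw [mem_iff_formAt_eq_zero C hH]
    have h1 := mem_closure_iff.1 (mem_closure_iff_walls.2 fun K hK => (h K hK).ge) H hH
    have h2 := mem_closure_iff.1 (mem_closure_iff_walls.2
      (fun K hK => by rw [map_neg, h K hK, neg_zero] : ∀ K ∈ walls C, 0 ≤ formAt C K (-x))) H hH
    rw [map_neg] at h2
    linarith

end

/-! ### Joins and meets of regions -/

/-- `J` is the join of `X` and `Y` in the poset of regions based at `B`. -/
structure IsJoin (B X Y J : A.Chamber) : Prop where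
  left : A.sep B X ⊆ A.sep B J
  right : A.sep B Y ⊆ A.sep B J
  least : ∀ U, A.sep B X ⊆ A.sep B U → A.sep B Y ⊆ A.sep B U → A.sep B J ⊆ A.sep B U

/-- `M` is the meet of `X` and `Y` in the poset of regions based at `B`. -/
structure IsMeet (B X Y M : A.Chamber) : Prop where
  left : A.sep B M ⊆ A.sep B X
  right : A.sep B M ⊆ A.sep B Y
  greatest : ∀ U, A.sep B U ⊆ A.sep B X → A.sep B U ⊆ A.sep B Y → A.sep B U ⊆ A.sep B M

theorem isLUB_pair_iff {B : A.Chamber} {X Y J : A.Regions B} :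
    IsLUB ({X, Y} : Set (A.Regions B)) J ↔ IsJoin B X Y J := by
  constructor
  · intro h
    exact ⟨h.1 (Set.mem_insert _ _), h.1 (Set.mem_insert_of_mem _ rfl), fun U hX hY =>
      h.2 (by rintro K (rfl | rfl); exacts [hX, hY])⟩
  · intro h
    exact ⟨by rintro K (rfl | rfl); exacts [h.left, h.right], fun U hU =>
      h.least U (hU (Set.mem_insert _ _)) (hU (Set.mem_insert_of_mem _ rfl))⟩

theorem isGLB_pair_iff {B : A.Chamber} {X Y M : A.Regions B} :
    IsGLB ({X, Y} : Set (A.Regions B)) M ↔ IsMeet B X Y M := by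
  constructor
  · intro h
    exact ⟨h.1 (Set.mem_insert _ _), h.1 (Set.mem_insert_of_mem _ rfl), fun U hX hY =>
      h.2 (by rintro K (rfl | rfl); exacts [hX, hY])⟩
  · intro h
    exact ⟨by rintro K (rfl | rfl); exacts [h.left, h.right], fun U hU =>
      h.greatest U (hU (Set.mem_insert _ _)) (hU (Set.mem_insert_of_mem _ rfl))⟩

theorem sep_opposite_subset {B X Y : A.Chamber} (h : A.sep B X ⊆ A.sep B Y) :
    A.sep B (opposite Y) ⊆ A.sep B (opposite X) := by
  intro H hH
  rw [mem_sep_opposite] at hH ⊢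
  exact ⟨hH.1, fun h' => hH.2 (h h')⟩

theorem sep_subset_opposite_comm {B X Y : A.Chamber} :
    A.sep B X ⊆ A.sep B (opposite Y) ↔ A.sep B Y ⊆ A.sep B (opposite X) := by
  constructor <;> intro h <;> simpa only [opposite_opposite] using sep_opposite_subset h

theorem IsJoin.opposite {B X Y J : A.Chamber} (h : IsJoin B X Y J) :
    IsMeet B (opposite X) (opposite Y) (opposite J) :=
  ⟨sep_opposite_subset h.left, sep_opposite_subset h.right, fun _ hX hY =>
    sep_subset_opposite_comm.1
      (h.least _ (sep_subset_opposite_comm.1 hX) (sep_subset_opposite_comm.1 hY))⟩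

theorem IsMeet.opposite {B X Y M : A.Chamber} (h : IsMeet B X Y M) :
    IsJoin B (opposite X) (opposite Y) (opposite M) := by
  refine ⟨sep_opposite_subset h.left, sep_opposite_subset h.right, fun U hX hY => ?_⟩
  have := sep_opposite_subset (h.greatest (RealArrangement.opposite U) ?_ ?_)
  · rwa [opposite_opposite] at this
  · simpa only [opposite_opposite] using sep_opposite_subset hX
  · simpa only [opposite_opposite] using sep_opposite_subset hY

theorem strongLattice_of_exists_isJoin (h : ∀ B X Y : A.Chamber, ∃ J, IsJoin B X Y J) :
    A.StrongLattice := by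
  intro B (X : A.Chamber) (Y : A.Chamber)
  obtain ⟨J, hJ⟩ := h B X Y
  obtain ⟨M, hM⟩ := h B (opposite X) (opposite Y)
  have := hM.opposite
  rw [opposite_opposite, opposite_opposite] at this
  exact ⟨⟨J, isLUB_pair_iff.2 hJ⟩, ⟨opposite M, isGLB_pair_iff.2 this⟩⟩

theorem strongLattice_of_exists_isMeet (h : ∀ B X Y : A.Chamber, ∃ M, IsMeet B X Y M) :
    A.StrongLattice := by
  refine strongLattice_of_exists_isJoin fun B X Y => ?_
  obtain ⟨M, hM⟩ := h B (opposite X) (opposite Y)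
  have := hM.opposite
  rw [opposite_opposite, opposite_opposite] at this
  exact ⟨_, this⟩

theorem StrongLattice.exists_isJoin (hL : A.StrongLattice) (B X Y : A.Chamber) :
    ∃ J, IsJoin B X Y J :=
  (hL B X Y).1.imp fun _ => isLUB_pair_iff.1

theorem StrongLattice.exists_isMeet (hL : A.StrongLattice) (B X Y : A.Chamber) :
    ∃ M, IsMeet B X Y M :=
  (hL B X Y).2.imp fun _ => isGLB_pair_iff.1

/-! ### The strong lattice property implies simpliciality -/

theorem StrongLattice.exists_join_of_finite (hL : A.StrongLattice) (B : A.Chamber)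
    {s : Set A.Chamber} (hs : s.Finite) : ∃ J : A.Chamber, (∀ X ∈ s, A.sep B X ⊆ A.sep B J) ∧
      ∀ U, (∀ X ∈ s, A.sep B X ⊆ A.sep B U) → A.sep B J ⊆ A.sep B U := by
  induction s, hs using Set.Finite.induction_on with
  | empty => exact ⟨B, by simp, by simp [A.sep_self]⟩
  | @insert a s _ _ ih =>
    obtain ⟨J, hJ, hJ'⟩ := ih
    obtain ⟨K, hK⟩ := hL.exists_isJoin B a J
    refine ⟨K, ?_, fun U hU => hK.least U (hU a (Set.mem_insert _ _))
      (hJ' U fun X hX => hU X (Set.mem_insert_of_mem _ hX))⟩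
    rintro X (rfl | hX)
    · exact hK.left
    · exact (hJ X hX).trans hK.right

theorem walls_finite (C : A.Chamber) : (walls C).Finite :=
  A.hyperplanes.finite_toSet.subset fun _ h => mem_hyperplanes_of_mem_walls h

/-- In the presence of joins, any choice of signs is taken on the walls of `C` by some chamber: the
join of the chambers across the walls in `T` lies below the opposite of the chamber across any other
wall. -/
theorem StrongLattice.exists_chamber_of_walls (hL : A.StrongLattice) (C : A.Chamber)
    (T : Set (Submodule ℝ (EuclideanSpace ℝ (Fin d)))) :
    ∃ J : A.Chamber, ∀ H ∈ walls C, H ∈ A.sep C J ↔ H ∈ T := by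
  have hfin : {D : A.Chamber | ∃ H ∈ walls C ∩ T, A.sep C D = {H}}.Finite := by
    refine Set.Finite.of_finite_image (f := fun D => A.sep C D) ?_
      fun D _ E _ h => A.sep_injective h
    refine ((walls_finite C).image fun H => ({H} : Set _)).subset ?_
    rintro _ ⟨D, ⟨H, hH, hD⟩, rfl⟩
    exact ⟨H, hH.1, hD.symm⟩
  obtain ⟨J, hJ, hJ'⟩ := hL.exists_join_of_finite C hfin
  refine ⟨J, fun H hH => ⟨fun h => ?_, fun h => ?_⟩⟩
  · obtain ⟨D, hD⟩ := hH
    by_contra hHT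
    have hle : A.sep C J ⊆ A.sep C (opposite D) := hJ' _ <| by
      rintro E ⟨K, hK, hE⟩
      rw [hE, Set.singleton_subset_iff, mem_sep_opposite, hD]
      refine ⟨mem_hyperplanes_of_mem_walls hK.1, fun hKH => hHT ?_⟩
      rw [Set.mem_singleton_iff] at hKH
      exact hKH ▸ hK.2
    have h1 := ((mem_sep_opposite C D).1 (hle h)).2
    rw [hD] at h1
    exact h1 rfl
  · obtain ⟨D, hD⟩ := hH
    have hle := hJ D ⟨H, ⟨⟨D, hD⟩, h⟩, hD⟩
    rw [hD] at hle
    exact hle rfl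

theorem StrongLattice.linearIndependent_walls (hL : A.StrongLattice) (C : A.Chamber) :
    LinearIndependent ℝ fun H : walls C => formAt C H.1 := by
  have := (walls_finite C).to_subtype
  have := Fintype.ofFinite (walls C)
  rw [Fintype.linearIndependent_iff]
  intro g hg K
  -- A chamber on which every term of the linear relation is nonpositive.
  obtain ⟨J, hJ⟩ := hL.exists_chamber_of_walls C {H | ∃ h : H ∈ walls C, 0 < g ⟨H, h⟩}
  obtain ⟨y, hy⟩ := J.nonempty
  have hsum : ∑ H : walls C, g H * formAt C H.1 y = 0 := by
    simpa using congrArg (fun f => f y) hg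
  have hpos : ∀ H : walls C, 0 < g H → formAt C H.1 y < 0 := fun H h =>
    (mem_sep_iff_formAt_neg (mem_hyperplanes_of_mem_walls H.2) hy).1 ((hJ H H.2).2 ⟨H.2, h⟩)
  have hneg : ∀ H : walls C, g H ≤ 0 → 0 < formAt C H.1 y := fun H h =>
    formAt_pos_of_notMem_sep (mem_hyperplanes_of_mem_walls H.2) hy fun h1 => by
      obtain ⟨_, h2⟩ := (hJ H H.2).1 h1
      exact h2.not_ge h
  have hle : ∀ H ∈ Finset.univ, g H * formAt C H.1 y ≤ 0 := fun H _ => by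
    rcases lt_or_ge 0 (g H) with h | h
    · exact (mul_neg_of_pos_of_neg h (hpos H h)).le
    · exact mul_nonpos_of_nonpos_of_nonneg h (hneg H h).le
  have h0 := (Finset.sum_eq_zero_iff_of_nonpos hle).1 hsum K (Finset.mem_univ K)
  refine (mul_eq_zero.1 h0).resolve_right ?_
  rcases lt_or_ge 0 (g K) with h | h
  · exact (hpos K h).ne
  · exact (hneg K h).ne'

/-- Linearly independent linear forms have a dual family of vectors. -/
theorem exists_dual_family {V ι : Type*} [AddCommGroup V] [Module ℝ V] [Finite ι] [DecidableEq ι]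
    {f : ι → V →ₗ[ℝ] ℝ} (hf : LinearIndependent ℝ f) :
    ∃ v : ι → V, ∀ i j, f i (v j) = if i = j then 1 else 0 := by
  have h : ∀ j, ∃ v, ∀ i, f i v = if i = j then 1 else 0 := by
    intro j
    have h1 : f j ∉ Submodule.span ℝ (Set.range fun i : {i // i ≠ j} => f i) := by
      have := hf.notMem_span_image (s := {i | i ≠ j}) (x := j) (by simp)
      rwa [Set.image_eq_range] at this
    obtain ⟨v, hv, hj⟩ := Set.not_subset.1 fun hle =>
      h1 (mem_span_of_iInf_ker_le_ker (L := fun i : {i // i ≠ j} => f i) (K := f j) hle)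
    have hv' : ∀ i, i ≠ j → f i v = 0 := by simpa using hv
    refine ⟨(f j v)⁻¹ • v, fun i => ?_⟩
    split_ifs with hij
    · subst hij
      simpa using inv_mul_cancel₀ hj
    · simp [hv' i hij]
  choose v hv using h
  exact ⟨v, fun i j => hv j i⟩

theorem StrongLattice.simplicial (hL : A.StrongLattice) : A.Simplicial := by
  classical
  intro C
  have := (walls_finite C).to_subtype
  have := Fintype.ofFinite (walls C)
  obtain ⟨v, hv⟩ := exists_dual_family (hL.linearIndependent_walls C)
  have hcoord : ∀ (g : walls C → ℝ) (i : walls C), formAt C i.1 (∑ j, g j • v j) = g i := by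
    intro g i
    simp [hv]
  refine ⟨PointedCone.hull ℝ (Set.range fun i => A.center.mkQ (v i)),
    PointedCone.IsSimplicial.hull (Set.finite_range _) ?_, ?_⟩
  · refine LinearIndependent.linearIndepOn_id ?_
    rw [Fintype.linearIndependent_iff]
    intro g hg i
    have h1 : A.center.mkQ (∑ j, g j • v j) = 0 := by simpa using hg
    rw [Submodule.mkQ_apply, Submodule.Quotient.mk_eq_zero] at h1
    rw [← hcoord g i, (mem_center_iff_walls C).1 h1 i i.2]
  · ext x
    rw [mem_closure_iff_walls, Set.mem_preimage, SetLike.mem_coe]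
    constructor
    · intro h
      have h1 : x - ∑ i : walls C, formAt C i.1 x • v i ∈ A.center := by
        rw [mem_center_iff_walls C]
        intro H hH
        rw [map_sub, hcoord (fun i => formAt C i.1 x) ⟨H, hH⟩, sub_self]
      have h2 : A.center.mkQ x = ∑ i : walls C, formAt C i.1 x • A.center.mkQ (v i) := by
        rw [← Submodule.Quotient.mk_eq_zero, ← Submodule.mkQ_apply, map_sub, sub_eq_zero] at h1
        rw [h1]
        simp
      rw [h2]
      refine Submodule.sum_mem _ fun i _ => ?_
      exact Submodule.smul_mem _ (⟨_, h i i.2⟩ : {c : ℝ // 0 ≤ c})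
        (Submodule.subset_span ⟨i, rfl⟩)
    · intro h
      have key : ∀ z ∈ PointedCone.hull ℝ (Set.range fun i => A.center.mkQ (v i)),
          ∀ x, A.center.mkQ x = z → ∀ H ∈ walls C, 0 ≤ formAt C H x := by
        have hcongr : ∀ x y, A.center.mkQ x = A.center.mkQ y → ∀ H ∈ walls C,
            formAt C H x = formAt C H y := by
          intro x y hxy H hH
          rw [← sub_eq_zero, ← map_sub, Submodule.mkQ_apply, Submodule.Quotient.mk_eq_zero,
            mem_center_iff_walls C] at hxy
          simpa [sub_eq_zero] using hxy H hH
        intro z hz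
        induction hz using Submodule.span_induction with
        | mem z hz =>
          obtain ⟨i, rfl⟩ := hz
          intro x hx H hH
          rw [hcongr x (v i) hx H hH, hv ⟨H, hH⟩ i]
          split_ifs <;> norm_num
        | zero =>
          intro x hx H hH
          rw [hcongr x 0 (by simpa using hx) H hH, map_zero]
        | add z w _ _ ihz ihw =>
          intro x hx H hH
          obtain ⟨z, rfl⟩ := A.center.mkQ_surjective z
          obtain ⟨w, rfl⟩ := A.center.mkQ_surjective w
          rw [hcongr x (z + w) (by simpa using hx) H hH, map_add]
          exact add_nonneg (ihz z rfl H hH) (ihw w rfl H hH)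
        | smul c z _ ih =>
          intro x hx H hH
          obtain ⟨z, rfl⟩ := A.center.mkQ_surjective z
          rw [hcongr x ((c : ℝ) • z) (by rw [hx]; rfl) H hH, map_smul]
          exact mul_nonneg c.2 (ih z rfl H hH)
      exact key _ h x rfl

/-! ### Simpliciality implies the strong lattice property -/

/-- The closure of a chamber of a simplicial arrangement is cut out by a family `c` of linear forms
that are coordinates modulo the common intersection of the hyperplanes, with respect to the vectors
`v`. -/
theorem Simplicial.exists_coordinates (hS : A.Simplicial) (C : A.Chamber) :
    ∃ (ι : Type) (_ : Fintype ι) (_ : DecidableEq ι) (v : ι → EuclideanSpace ℝ (Fin d))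
      (c : ι → EuclideanSpace ℝ (Fin d) →ₗ[ℝ] ℝ),
      (∀ i j, c i (v j) = if i = j then 1 else 0) ∧
      (∀ x, x - ∑ i, c i x • v i ∈ A.center) ∧
      ∀ x, x ∈ closure C.carrier ↔ ∀ i, 0 ≤ c i x := by
  classical
  obtain ⟨σ, ⟨s, hs, hli, rfl⟩, hC⟩ := hS C
  have := hs.fintype
  have hspan : ⊤ ≤ Submodule.span ℝ (Set.range fun i : s => id i.1) := by
    simp only [id, Subtype.range_coe_subtype, Set.ofPred_mem_eq]
    have hmem : ∀ x ∈ C.carrier, A.center.mkQ x ∈ Submodule.span ℝ s := fun x hx => by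
      have h1 : x ∈ closure C.carrier := subset_closure hx
      rw [hC] at h1
      exact PointedCone.hull_le_span ℝ s h1
    rintro z -
    obtain ⟨u, rfl⟩ := A.center.mkQ_surjective z
    obtain ⟨x, hx⟩ := C.nonempty
    obtain ⟨t, h2, h3⟩ := (((eventually_add_smul_mem hx u).filter_mono
      nhdsWithin_le_nhds).and (self_mem_nhdsWithin (a := (0 : ℝ)) (s := {0}ᶜ))).exists
    have h4 := Submodule.sub_mem _ (hmem _ h2) (hmem x hx)
    rw [← map_sub, add_sub_cancel_left, map_smul] at h4
    exact (Submodule.smul_mem_iff _ h3).1 h4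
  let b : Module.Basis s ℝ (EuclideanSpace ℝ (Fin d) ⧸ A.center) := Module.Basis.mk hli hspan
  have hb : ∀ i : s, b i = i.1 := fun i => by simp [b]
  choose v hv using fun i : s => A.center.mkQ_surjective i.1
  refine ⟨s, inferInstance, inferInstance, v, fun i => b.coord i ∘ₗ A.center.mkQ, ?_, ?_, ?_⟩
  · intro i j
    rw [LinearMap.comp_apply, hv, ← hb j]
    simp [Finsupp.single_apply, eq_comm]
  · intro x
    rw [← Submodule.Quotient.mk_eq_zero, ← Submodule.mkQ_apply, map_sub, sub_eq_zero]
    conv_lhs => rw [← b.sum_repr (A.center.mkQ x)]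
    rw [map_sum]
    refine Finset.sum_congr rfl fun i _ => ?_
    rw [map_smul, hv, hb]
    rfl
  · intro x
    rw [hC, Set.mem_preimage, SetLike.mem_coe]
    constructor
    · intro h i
      change 0 ≤ b.coord i (A.center.mkQ x)
      generalize A.center.mkQ x = z at h ⊢
      induction h using Submodule.span_induction with
      | mem z hz =>
        rw [show z = b ⟨z, hz⟩ from (hb ⟨z, hz⟩).symm]
        simp only [Module.Basis.coord_apply, Module.Basis.repr_self, Finsupp.single_apply]
        split_ifs <;> norm_num
      | zero => simp
      | add z w _ _ ihz ihw => rw [map_add]; exact add_nonneg ihz ihw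
      | smul c z _ ih =>
        rw [show c • z = (c : ℝ) • z from rfl, map_smul]
        exact mul_nonneg c.2 ih
    · intro h
      rw [← b.sum_repr (A.center.mkQ x)]
      refine Submodule.sum_mem _ fun i _ => ?_
      rw [hb]
      exact Submodule.smul_mem _ (⟨_, h i⟩ : {c : ℝ // 0 ≤ c}) (Submodule.subset_span i.2)

/-- A wall of `C` contains a point at which the forms of all the other hyperplanes are positive. -/
theorem exists_mem_wall {C : A.Chamber} {H : Submodule ℝ (EuclideanSpace ℝ (Fin d))}
    (hH : H ∈ walls C) :
    ∃ y, formAt C H y = 0 ∧ ∀ K ∈ A.hyperplanes, K ≠ H → 0 < formAt C K y := by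
  have hHA := mem_hyperplanes_of_mem_walls hH
  obtain ⟨D, hD⟩ := hH
  obtain ⟨x, hx⟩ := C.nonempty
  obtain ⟨z, hz⟩ := D.nonempty
  have hneg := (mem_sep_iff_formAt_neg (C := C) hHA hz).1 (by rw [hD]; rfl)
  have hpos := formAt_pos hHA hx
  refine ⟨(-formAt C H z) • x + formAt C H x • z, ?_, fun K hK hne => ?_⟩
  · simp only [map_add, map_smul, smul_eq_mul]
    ring
  · have h1 := formAt_pos hK hx
    have h2 := formAt_pos_of_notMem_sep (C := C) hK hz (by rw [hD]; exact hne)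
    simp only [map_add, map_smul, smul_eq_mul]
    have := mul_pos (neg_pos.2 hneg) h1
    have := mul_pos hpos h2
    linarith

/-- In a simplicial arrangement, two walls `H₁`, `H₂` of a chamber `C` meet in a face of `C` of
codimension two, and there is a chamber opposite to `C` across this face: the hyperplanes that
separate it from `C` are those that contain the face, that is, those whose forms are nonnegative
combinations of the forms of `H₁` and `H₂`. -/
theorem Simplicial.exists_opposite_across (hS : A.Simplicial) {C : A.Chamber}
    {H₁ H₂ : Submodule ℝ (EuclideanSpace ℝ (Fin d))} (h₁ : H₁ ∈ walls C) (h₂ : H₂ ∈ walls C)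
    (hne : H₁ ≠ H₂) :
    ∃ W : A.Chamber, ∀ H ∈ A.hyperplanes, H ∈ A.sep C W ↔ ∃ a b : ℝ, 0 ≤ a ∧ 0 ≤ b ∧
      ∀ x, formAt C H x = a * formAt C H₁ x + b * formAt C H₂ x := by
  classical
  obtain ⟨ι, _, _, v, c, hcv, hcenter, hcl⟩ := hS.exists_coordinates C
  have hexp : ∀ H ∈ A.hyperplanes, ∀ x, formAt C H x = ∑ i, c i x * formAt C H (v i) := by
    intro H hH x
    have h3 := (mem_iff_formAt_eq_zero C hH).1 (mem_center_iff.1 (hcenter x) H hH)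
    rw [map_sub, sub_eq_zero] at h3
    rw [h3]
    simp
  have hnonneg : ∀ H ∈ A.hyperplanes, ∀ i, 0 ≤ formAt C H (v i) := by
    intro H hH i
    refine mem_closure_iff.1 ((hcl (v i)).2 fun j => ?_) H hH
    rw [hcv]
    split_ifs <;> norm_num
  -- Every wall is the kernel of one of the coordinates.
  have hwall : ∀ H ∈ walls C, ∃ i, ∃ r > 0, ∀ x, formAt C H x = r * c i x := by
    intro H hH
    have hHA := mem_hyperplanes_of_mem_walls hH
    obtain ⟨p, hp⟩ := C.nonempty
    obtain ⟨i, hi⟩ : ∃ i, 0 < formAt C H (v i) := by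
      by_contra! h
      have h3 := formAt_pos hHA hp
      rw [hexp H hHA] at h3
      refine h3.ne' (Finset.sum_eq_zero fun i _ => ?_)
      rw [le_antisymm (h i) (hnonneg H hHA i), mul_zero]
    obtain ⟨y, hy0, hy⟩ := exists_mem_wall hH
    have hy_cl : ∀ j, 0 ≤ c j y := (hcl y).1 <| mem_closure_iff.2 fun K hK => by
      by_cases hKH : K = H
      · rw [hKH, hy0]
      · exact (hy K hK hKH).le
    have hciy : c i y = 0 := by
      rw [hexp H hHA] at hy0
      have := (Finset.sum_eq_zero_iff_of_nonneg fun j _ =>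
        mul_nonneg (hy_cl j) (hnonneg H hHA j)).1 hy0 i (Finset.mem_univ i)
      exact (mul_eq_zero.1 this).resolve_right hi.ne'
    -- Near `y`, the whole of `H` lies in the closure of `C`, so that `c i` vanishes on `H`.
    have hone : ∀ u, formAt C H u = 0 → 0 ≤ c i u := by
      intro u hu
      have hev : ∀ᶠ t : ℝ in nhdsWithin 0 (Set.Ioi 0), ∀ K ∈ A.hyperplanes,
          0 ≤ formAt C K (y + t • u) := by
        rw [Filter.eventually_all_finset]
        intro K hK
        by_cases hKH : K = H
        · subst hKH
          exact Filter.Eventually.of_forall fun t => by simp [hy0, hu]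
        · have h3 : Continuous fun t : ℝ => formAt C K (y + t • u) := by
            simp only [map_add, map_smul, smul_eq_mul]
            fun_prop
          have h4 := (h3.tendsto 0).mono_left (nhdsWithin_le_nhds (s := Set.Ioi 0))
          exact (h4.eventually_const_lt (by simpa using hy K hK hKH)).mono fun t ht => ht.le
      obtain ⟨t, ht, ht0⟩ := (hev.and self_mem_nhdsWithin).exists
      have h5 := (hcl _).1 (mem_closure_iff.2 ht) i
      rw [map_add, hciy, zero_add, map_smul, smul_eq_mul] at h5
      exact nonneg_of_mul_nonneg_right h5 ht0
    have hker : ∀ u, formAt C H u = 0 → c i u = 0 := fun u hu => by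
      have h3 := hone u hu
      have h4 := hone (-u) (by simp [hu])
      rw [map_neg] at h4
      linarith
    refine ⟨i, formAt C H (v i), hi, fun x => ?_⟩
    have h3 := hker (x - (formAt C H x / formAt C H (v i)) • v i) (by
      simp [div_mul_cancel₀ _ hi.ne'])
    rw [map_sub, map_smul, hcv, if_pos rfl, smul_eq_mul, mul_one, sub_eq_zero] at h3
    rw [h3, mul_div_cancel₀ _ hi.ne']
  obtain ⟨i, r, hr, hi⟩ := hwall H₁ h₁
  obtain ⟨j, s, hs, hj⟩ := hwall H₂ h₂
  have hij : i ≠ j := by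
    rintro rfl
    refine hne (Submodule.ext fun x => ?_)
    rw [mem_iff_formAt_eq_zero C (mem_hyperplanes_of_mem_walls h₁),
      mem_iff_formAt_eq_zero C (mem_hyperplanes_of_mem_walls h₂), hi, hj]
    simp [hr.ne', hs.ne']
  -- A point in the relative interior of the face.
  let y := ∑ k ∈ Finset.univ.filter (fun k => k ≠ i ∧ k ≠ j), v k
  have hy : ∀ H, formAt C H y =
      ∑ k ∈ Finset.univ.filter (fun k => k ≠ i ∧ k ≠ j), formAt C H (v k) := fun H => by simp [y]
  obtain ⟨p, hp⟩ := C.nonempty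
  have hev : ∀ᶠ t : ℝ in nhdsWithin 0 (Set.Ioi 0), ∀ H ∈ A.hyperplanes,
      0 < formAt C H y → 0 < formAt C H (y - t • p) := by
    rw [Filter.eventually_all_finset]
    intro H hH
    rw [Filter.eventually_imp_distrib_left]
    intro hpos
    have h3 : Continuous fun t : ℝ => formAt C H (y - t • p) := by
      simp only [map_sub, map_smul, smul_eq_mul]
      fun_prop
    have h4 := (h3.tendsto 0).mono_left (nhdsWithin_le_nhds (s := Set.Ioi 0))
    exact h4.eventually_const_lt (by simpa using hpos)
  obtain ⟨t, ht, ht0⟩ := (hev.and self_mem_nhdsWithin).exists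
  have hy_nonneg : ∀ H ∈ A.hyperplanes, 0 ≤ formAt C H y := fun H hH => by
    rw [hy]
    exact Finset.sum_nonneg fun k _ => hnonneg H hH k
  have hval : ∀ H ∈ A.hyperplanes, formAt C H y = 0 → formAt C H (y - t • p) < 0 := by
    intro H hH h0
    have := mul_pos ht0 (formAt_pos hH hp)
    rw [map_sub, h0, map_smul, smul_eq_mul]
    linarith
  obtain ⟨W, hW⟩ := exists_mem_chamber (A := A) (x := y - t • p) fun H hH hmem => by
    rw [mem_iff_formAt_eq_zero C hH] at hmem
    rcases (hy_nonneg H hH).eq_or_lt with h | h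
    · exact (hval H hH h.symm).ne hmem
    · exact (ht H hH h).ne' hmem
  refine ⟨W, fun H hH => ?_⟩
  have hiff : H ∈ A.sep C W ↔ formAt C H y = 0 := by
    rw [mem_sep_iff_formAt_neg hH hW]
    refine ⟨fun h => ?_, hval H hH⟩
    by_contra h0
    exact (ht H hH (lt_of_le_of_ne (hy_nonneg H hH) (Ne.symm h0))).not_gt h
  rw [hiff]
  constructor
  · intro h0
    refine ⟨formAt C H (v i) / r, formAt C H (v j) / s, div_nonneg (hnonneg H hH i) hr.le,
      div_nonneg (hnonneg H hH j) hs.le, fun x => ?_⟩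
    rw [hy] at h0
    have h3 := (Finset.sum_eq_zero_iff_of_nonneg fun k _ => hnonneg H hH k).1 h0
    rw [hexp H hH x, Finset.sum_eq_add i j hij, hi, hj]
    · field_simp
    · intro k _ hk
      rw [h3 k (by simpa using hk), mul_zero]
    · simp
    · simp
  · rintro ⟨a, b, -, -, hab⟩
    have hz : ∀ k, k ≠ i → k ≠ j → formAt C H (v k) = 0 := fun k hki hkj => by
      rw [hab, hi, hj, hcv, hcv, if_neg hki.symm, if_neg hkj.symm]
      simp
    rw [hy]
    refine Finset.sum_eq_zero fun k hk => ?_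
    simp only [Finset.mem_filter] at hk
    exact hz k hk.2.1 hk.2.2

/-- Two chambers that cover `Z` in the poset of regions based at `B` have a join: the chamber
opposite to `Z` across the common face of codimension two. -/
theorem Simplicial.exists_isJoin_of_covers (hS : A.Simplicial) {B Z X Y : A.Chamber}
    {H₁ H₂ : Submodule ℝ (EuclideanSpace ℝ (Fin d))} (hX : A.sep Z X = {H₁})
    (hY : A.sep Z Y = {H₂}) (hne : H₁ ≠ H₂) (hB₁ : H₁ ∉ A.sep B Z) (hB₂ : H₂ ∉ A.sep B Z) :
    ∃ J, IsJoin B X Y J := by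
  have hw₁ : H₁ ∈ walls Z := ⟨X, hX⟩
  have hw₂ : H₂ ∈ walls Z := ⟨Y, hY⟩
  have hA₁ := mem_hyperplanes_of_mem_walls hw₁
  have hA₂ := mem_hyperplanes_of_mem_walls hw₂
  obtain ⟨W, hW⟩ := hS.exists_opposite_across hw₁ hw₂ hne
  have hW₁ : H₁ ∈ A.sep Z W := (hW H₁ hA₁).2 ⟨1, 0, zero_le_one, le_rfl, by simp⟩
  have hW₂ : H₂ ∈ A.sep Z W := (hW H₂ hA₂).2 ⟨0, 1, le_rfl, zero_le_one, by simp⟩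
  have hdisj : Disjoint (A.sep B Z) (A.sep Z W) := by
    rw [Set.disjoint_left]
    intro H hHB hH
    obtain ⟨p, hp⟩ := B.nonempty
    obtain ⟨a, b, ha, hb, hab⟩ := (hW H hH.1).1 hH
    have q₁ := formAt_pos_of_notMem_sep (C := Z) hA₁ hp (by rwa [A.sep_comm])
    have q₂ := formAt_pos_of_notMem_sep (C := Z) hA₂ hp (by rwa [A.sep_comm])
    rw [A.sep_comm, mem_sep_iff_formAt_neg hH.1 hp, hab] at hHB
    have := mul_nonneg ha q₁.le
    have := mul_nonneg hb q₂.le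
    linarith
  have hBX : A.sep B X = A.sep B Z ∪ {H₁} := by
    rw [sep_eq_union (D := Z) (by rwa [hX, Set.disjoint_singleton_right]), hX]
  have hBY : A.sep B Y = A.sep B Z ∪ {H₂} := by
    rw [sep_eq_union (D := Z) (by rwa [hY, Set.disjoint_singleton_right]), hY]
  refine ⟨W, ?_, ?_, fun U hXU hYU => ?_⟩
  · rw [hBX, sep_eq_union hdisj]
    exact Set.union_subset_union_right _ (Set.singleton_subset_iff.2 hW₁)
  · rw [hBY, sep_eq_union hdisj]
    exact Set.union_subset_union_right _ (Set.singleton_subset_iff.2 hW₂)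
  · rw [hBX, Set.union_subset_iff, Set.singleton_subset_iff] at hXU
    rw [hBY, Set.union_subset_iff, Set.singleton_subset_iff] at hYU
    have hBU := sep_eq_union (disjoint_sep_of_subset hXU.1)
    rw [hBU] at hXU hYU
    rw [sep_eq_union hdisj, hBU]
    refine Set.union_subset_union_right _ fun H hH => ?_
    obtain ⟨u, hu⟩ := U.nonempty
    obtain ⟨a, b, ha, hb, hab⟩ := (hW H hH.1).1 hH
    by_contra hnot
    have h₀ := formAt_pos_of_notMem_sep hH.1 hu hnot
    rw [hab] at h₀
    have := mul_nonpos_of_nonneg_of_nonpos ha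
      ((mem_sep_iff_formAt_neg hA₁ hu).1 (hXU.2.resolve_left hB₁)).le
    have := mul_nonpos_of_nonneg_of_nonpos hb
      ((mem_sep_iff_formAt_neg hA₂ hu).1 (hYU.2.resolve_left hB₂)).le
    linarith

/-- A chamber strictly above `Z` is above some chamber that covers `Z`. -/
theorem exists_cover_le {B Z X : A.Chamber} (hne : Z ≠ X) (hle : A.sep B Z ⊆ A.sep B X) :
    ∃ (X' : A.Chamber) (H : Submodule ℝ (EuclideanSpace ℝ (Fin d))), A.sep Z X' = {H} ∧
      H ∉ A.sep B Z ∧ A.sep B Z ⊂ A.sep B X' ∧ A.sep B X' ⊆ A.sep B X := by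
  obtain ⟨X', H, hH, hX'⟩ := exists_sep_eq_singleton hne
  have hdisj := disjoint_sep_of_subset hle
  have h1 : H ∉ A.sep B Z := Set.disjoint_right.1 hdisj hH
  have h2 : A.sep B X' = A.sep B Z ∪ {H} := by
    rw [sep_eq_union (D := Z) (by rwa [hX', Set.disjoint_singleton_right]), hX']
  refine ⟨X', H, hX', h1, ?_, ?_⟩
  · rw [h2]
    exact ⟨Set.subset_union_left, fun h => h1 (h (Or.inr rfl))⟩
  · rw [h2, sep_eq_union hdisj]
    exact Set.union_subset_union_right _ (Set.singleton_subset_iff.2 hH)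

/-- Joins of pairs of covers propagate to all pairs with a common lower bound `Z`, by descending
induction on `Z`. -/
theorem Simplicial.exists_isJoin_of_le (hS : A.Simplicial) {B Z X Y : A.Chamber}
    (hX : A.sep B Z ⊆ A.sep B X) (hY : A.sep B Z ⊆ A.sep B Y) : ∃ J, IsJoin B X Y J := by
  induction hn : A.hyperplanes.card - (A.sep B Z).ncard using Nat.strong_induction_on
    generalizing Z X Y with
  | _ n ih =>
    by_cases hZX : Z = X
    · exact ⟨Y, hZX ▸ hY, subset_rfl, fun U _ hU => hU⟩
    by_cases hZY : Z = Y
    · exact ⟨X, subset_rfl, hZY ▸ hX, fun U hU _ => hU⟩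
    obtain ⟨X', H₁, hX', hB₁, hZX', hX'X⟩ := exists_cover_le hZX hX
    obtain ⟨Y', H₂, hY', hB₂, hZY', hY'Y⟩ := exists_cover_le hZY hY
    have hlt : ∀ Z' : A.Chamber, A.sep B Z ⊂ A.sep B Z' →
        A.hyperplanes.card - (A.sep B Z').ncard < n := by
      intro Z' h
      have h1 := Set.ncard_lt_ncard h (sep_finite B Z')
      have h2 : (A.sep B Z').ncard ≤ A.hyperplanes.card := by
        rw [← Set.ncard_coe_finset]
        exact Set.ncard_le_ncard (fun H hH => hH.1) A.hyperplanes.finite_toSet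
      omega
    obtain ⟨J, hJ⟩ : ∃ J, IsJoin B X' Y' J := by
      by_cases hne : H₁ = H₂
      · obtain rfl : X' = Y' := A.sep_injective (C₀ := Z) (by rw [hX', hY', hne])
        exact ⟨X', subset_rfl, subset_rfl, fun U hU _ => hU⟩
      · exact hS.exists_isJoin_of_covers hX' hY' hne hB₁ hB₂
    -- `X ∨ Y = Y ∨ (X ∨ J)`, where both joins on the right have a larger common lower bound.
    obtain ⟨K, hK⟩ := ih _ (hlt X' hZX') hX'X hJ.left rfl
    obtain ⟨L, hL⟩ := ih _ (hlt Y' hZY') hY'Y (hJ.right.trans hK.right) rfl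
    exact ⟨L, hK.left.trans hL.right, hL.left, fun U hXU hYU => hL.least U hYU
      (hK.least U hXU (hJ.least U (hX'X.trans hXU) (hY'Y.trans hYU)))⟩

theorem Simplicial.strongLattice (hS : A.Simplicial) : A.StrongLattice :=
  strongLattice_of_exists_isJoin fun B _ _ =>
    hS.exists_isJoin_of_le (Z := B) (by simp [A.sep_self]) (by simp [A.sep_self])

/-! ### Positive paths and crossings -/

open Classical in
/-- The number of times that a positive path crosses the hyperplane `H`. -/
noncomputable def PosPath.crossings (H : Submodule ℝ (EuclideanSpace ℝ (Fin d))) :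
    {C D : A.Chamber} → A.PosPath C D → ℕ
  | _, _, .nil => 0
  | C, _, .cons (v := E) _ p => (if H ∈ A.sep C E then 1 else 0) + PosPath.crossings H p

theorem PosPath.crossings_append (H : Submodule ℝ (EuclideanSpace ℝ (Fin d)))
    {C D E : A.Chamber} (p : A.PosPath C D) (q : A.PosPath D E) :
    PosPath.crossings H (p.append q) = PosPath.crossings H p + PosPath.crossings H q := by
  induction p with
  | nil => simp [PosPath.crossings]
  | cons h p ih =>
    rw [SimpleGraph.Walk.cons_append, PosPath.crossings, PosPath.crossings, ih, add_assoc]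

open Classical in
theorem PosPath.le_crossings {C D : A.Chamber} (p : A.PosPath C D)
    (H : Submodule ℝ (EuclideanSpace ℝ (Fin d))) :
    (if H ∈ A.sep C D then 1 else 0) ≤ PosPath.crossings H p := by
  induction p with
  | nil => simp [A.sep_self]
  | @cons C E D h p ih =>
    rw [PosPath.crossings]
    have := mem_sep_triangle C E D H
    split_ifs at * <;> first | omega | tauto

theorem PosPath.sum_crossings {C D : A.Chamber} (p : A.PosPath C D) :
    ∑ H ∈ A.hyperplanes, PosPath.crossings H p = p.length := by
  classical
  induction p with
  | nil => simp [PosPath.crossings]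
  | @cons C E D h p ih =>
    simp only [PosPath.crossings]
    rw [Finset.sum_add_distrib, ih, SimpleGraph.Walk.length_cons, add_comm]
    congr 1
    obtain ⟨H, hH⟩ := h
    have hHA : H ∈ A.hyperplanes := (show H ∈ A.sep C E by rw [hH]; rfl).1
    simp only [hH, Set.mem_singleton_iff]
    simp [hHA]

open Classical in
theorem ncard_sep_eq_sum (C D : A.Chamber) :
    (A.sep C D).ncard = ∑ H ∈ A.hyperplanes, if H ∈ A.sep C D then 1 else 0 := by
  rw [Finset.sum_boole, Nat.cast_id, ← Set.ncard_coe_finset]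
  congr 1
  ext H
  simpa using fun h : H ∈ A.sep C D => h.1

theorem PosPath.ncard_sep_le_length {C D : A.Chamber} (p : A.PosPath C D) :
    (A.sep C D).ncard ≤ p.length := by
  rw [ncard_sep_eq_sum, ← p.sum_crossings]
  exact Finset.sum_le_sum fun H _ => p.le_crossings H

theorem exists_posPath_length_eq (C D : A.Chamber) :
    ∃ p : A.PosPath C D, p.length = (A.sep C D).ncard := by
  induction hn : (A.sep C D).ncard generalizing C with
  | zero =>
    obtain rfl := eq_of_sep_eq_empty ((Set.ncard_eq_zero (sep_finite C D)).1 hn)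
    exact ⟨.nil, rfl⟩
  | succ n ih =>
    have hne : C ≠ D := by
      rintro rfl
      simp [A.sep_self] at hn
    obtain ⟨E, H, hH, hE⟩ := exists_sep_eq_singleton hne
    have hED : A.sep E D = A.sep C D \ {H} := by
      ext K
      have := mem_sep_triangle C E D K
      rw [hE, Set.mem_singleton_iff] at this
      rw [Set.mem_sdiff, Set.mem_singleton_iff]
      by_cases hK : K = H
      · subst hK
        tauto
      · tauto
    obtain ⟨p, hp⟩ := ih E (by rw [hED, Set.ncard_sdiff_singleton_of_mem hH, hn]; rfl)
    exact ⟨.cons (show A.graph.Adj C E from ⟨H, hE⟩) p, congrArg (· + 1) hp⟩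

theorem PosPath.isMinimal_iff {C D : A.Chamber} {p : A.PosPath C D} :
    p.IsMinimal ↔ p.length = (A.sep C D).ncard := by
  constructor
  · intro h
    obtain ⟨q, hq⟩ := exists_posPath_length_eq C D
    exact le_antisymm (hq ▸ h q) p.ncard_sep_le_length
  · intro h q
    rw [h]
    exact q.ncard_sep_le_length

theorem exists_isMinimal (C D : A.Chamber) : ∃ p : A.PosPath C D, p.IsMinimal := by
  obtain ⟨p, hp⟩ := exists_posPath_length_eq C D
  exact ⟨p, PosPath.isMinimal_iff.2 hp⟩

open Classical in
/-- A positive minimal path crosses each separating hyperplane once, and no other hyperplane. -/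
theorem PosPath.IsMinimal.crossings_eq {C D : A.Chamber} {p : A.PosPath C D} (hp : p.IsMinimal)
    {H : Submodule ℝ (EuclideanSpace ℝ (Fin d))} (hH : H ∈ A.hyperplanes) :
    PosPath.crossings H p = if H ∈ A.sep C D then 1 else 0 := by
  have h1 := PosPath.isMinimal_iff.1 hp
  rw [ncard_sep_eq_sum, ← p.sum_crossings] at h1
  exact ((Finset.sum_eq_sum_iff_of_le fun H _ => p.le_crossings H).1 h1.symm H hH).symm

theorem PosPath.Equiv.crossings_eq {C D : A.Chamber} {p q : A.PosPath C D} (h : p.Equiv q)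
    {H : Submodule ℝ (EuclideanSpace ℝ (Fin d))} (hH : H ∈ A.hyperplanes) :
    PosPath.crossings H p = PosPath.crossings H q := by
  induction h with
  | minimal p q hp hq => rw [hp.crossings_eq hH, hq.crossings_eq hH]
  | refl p => rfl
  | symm _ ih => exact ih.symm
  | trans _ _ ih₁ ih₂ => exact ih₁.trans ih₂
  | append _ _ ih₁ ih₂ => rw [PosPath.crossings_append, PosPath.crossings_append, ih₁, ih₂]

theorem PosPath.IsMinimal.of_cons {C D E : A.Chamber} {h : A.graph.Adj C D} {p : A.PosPath D E}
    (hp : PosPath.IsMinimal (SimpleGraph.Walk.cons h p)) : p.IsMinimal := fun q => by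
  simpa using hp (.cons h q)

theorem PosPath.IsMinimal.disjoint_of_cons {C D E : A.Chamber} {h : A.graph.Adj C D}
    {p : A.PosPath D E} (hp : PosPath.IsMinimal (SimpleGraph.Walk.cons h p)) :
    Disjoint (A.sep C D) (A.sep D E) := by
  classical
  rw [Set.disjoint_left]
  intro H h1 h2
  have h3 := hp.crossings_eq h1.1
  rw [PosPath.crossings, hp.of_cons.crossings_eq h1.1, if_pos h1, if_pos h2] at h3
  split_ifs at h3
  omega

theorem PosPath.IsMinimal.append {C D E : A.Chamber} {p : A.PosPath C D} {q : A.PosPath D E}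
    (hp : p.IsMinimal) (hq : q.IsMinimal) (h : Disjoint (A.sep C D) (A.sep D E)) :
    PosPath.IsMinimal (SimpleGraph.Walk.append p q) := by
  rw [PosPath.isMinimal_iff] at *
  rw [sep_eq_union h, Set.ncard_union_eq h (sep_finite C D) (sep_finite D E), ← hp, ← hq,
    SimpleGraph.Walk.length_append]

theorem PosPath.isMinimal_of_adj {C D : A.Chamber} (h : A.graph.Adj C D) :
    PosPath.IsMinimal (SimpleGraph.Walk.cons h SimpleGraph.Walk.nil) := by
  rw [PosPath.isMinimal_iff]
  obtain ⟨H, hH⟩ := id h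
  rw [hH, Set.ncard_singleton, SimpleGraph.Walk.length_cons, SimpleGraph.Walk.length_nil]

/-! ### The strong lattice property implies property D -/

namespace StrongLattice

/-- A meet of `X` and `Y` in the poset of regions based at `B`. -/
noncomputable def meet (hL : A.StrongLattice) (B X Y : A.Chamber) : A.Chamber :=
  (hL.exists_isMeet B X Y).choose

/-- The greatest chamber `E` such that `(E → C)` is a final factor of `(K → D)(D → C)`: the meet,
in the poset of regions based at `D`, of `K` and of the opposite of `C`. -/
noncomputable def lastFactor (hL : A.StrongLattice) (K D C : A.Chamber) : A.Chamber :=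
  hL.meet D K (opposite C)

theorem subset_sep_lastFactor_iff (hL : A.StrongLattice) {K D C E : A.Chamber} :
    A.sep D E ⊆ A.sep D (hL.lastFactor K D C) ↔
      A.sep D E ⊆ A.sep D K ∧ Disjoint (A.sep D E) (A.sep D C) := by
  have hM : IsMeet D K (opposite C) (hL.lastFactor K D C) :=
    (hL.exists_isMeet D K (opposite C)).choose_spec
  have hopp : A.sep D E ⊆ A.sep D (opposite C) ↔ Disjoint (A.sep D E) (A.sep D C) := by
    rw [Set.disjoint_left]
    exact ⟨fun h H hH => ((mem_sep_opposite D C).1 (h hH)).2,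
      fun h H hH => (mem_sep_opposite D C).2 ⟨hH.1, h hH⟩⟩
  rw [← hopp]
  exact ⟨fun h => ⟨h.trans hM.left, h.trans hM.right⟩, fun h => hM.greatest E h.1 h.2⟩

theorem sep_lastFactor (hL : A.StrongLattice) (K D C : A.Chamber) :
    A.sep C (hL.lastFactor K D C) = A.sep C D ∪ A.sep D (hL.lastFactor K D C) := by
  refine sep_eq_union ?_
  rw [A.sep_comm C D]
  exact (hL.subset_sep_lastFactor_iff.1 subset_rfl).2.symm

theorem lastFactor_self (hL : A.StrongLattice) (K C : A.Chamber) : hL.lastFactor K C C = K :=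
  A.sep_injective (C₀ := C) <| (hL.subset_sep_lastFactor_iff.1 subset_rfl).1.antisymm <|
    hL.subset_sep_lastFactor_iff.2 ⟨subset_rfl, by rw [A.sep_self]; exact Set.disjoint_empty _⟩

/-- Final factors can be computed step by step along a positive minimal path from `D` to `C'`. -/
theorem lastFactor_lastFactor (hL : A.StrongLattice) {K D C C' : A.Chamber}
    (h : Disjoint (A.sep D C) (A.sep C C')) :
    hL.lastFactor (hL.lastFactor K D C) C C' = hL.lastFactor K D C' := by
  have hDC' := sep_eq_union h
  have hK := hL.sep_lastFactor K D C
  obtain ⟨hK₁, hK₂⟩ := hL.subset_sep_lastFactor_iff.1 (subset_refl (A.sep D (hL.lastFactor K D C)))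
  obtain ⟨hF₁, hF₂⟩ := hL.subset_sep_lastFactor_iff.1
    (subset_refl (A.sep D (hL.lastFactor K D C')))
  rw [hDC', Set.disjoint_union_right] at hF₂
  obtain ⟨hE₁, hE₂⟩ := hL.subset_sep_lastFactor_iff.1
    (subset_refl (A.sep C (hL.lastFactor (hL.lastFactor K D C) C C')))
  have hCD : A.sep C D ⊆ A.sep C (hL.lastFactor (hL.lastFactor K D C) C C') :=
    hL.subset_sep_lastFactor_iff.2 ⟨hK ▸ Set.subset_union_left, by rwa [A.sep_comm C D]⟩
  have hE := sep_eq_union (disjoint_sep_of_subset hCD)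
  have hdisj := disjoint_sep_of_subset hCD
  refine A.sep_injective (C₀ := D) (subset_antisymm ?_ ?_)
  · rw [hE, hK, Set.union_subset_iff] at hE₁
    rw [hE, Set.disjoint_union_left] at hE₂
    refine hL.subset_sep_lastFactor_iff.2 ⟨?_, ?_⟩
    · exact (Disjoint.subset_right_of_subset_union hE₁.2 hdisj.symm).trans hK₁
    · rw [hDC', Set.disjoint_union_right, A.sep_comm D C]
      exact ⟨hdisj.symm, hE₂.2⟩
  · have hF : A.sep C (hL.lastFactor K D C') =
        A.sep C D ∪ A.sep D (hL.lastFactor K D C') := by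
      refine sep_eq_union ?_
      rw [A.sep_comm C D]
      exact hF₂.1.symm
    have hle : A.sep C (hL.lastFactor K D C') ⊆
        A.sep C (hL.lastFactor (hL.lastFactor K D C) C C') := by
      refine hL.subset_sep_lastFactor_iff.2 ⟨?_, ?_⟩
      · rw [hF, hK]
        exact Set.union_subset_union_right _ (hL.subset_sep_lastFactor_iff.2 ⟨hF₁, hF₂.1⟩)
      · rw [hF, Set.disjoint_union_left, A.sep_comm C D]
        exact ⟨h, hF₂.2⟩
    rw [hF, hE, Set.union_subset_iff] at hle
    rw [A.sep_comm D C] at hF₂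
    exact Disjoint.subset_right_of_subset_union hle.2 hF₂.1

/-- The greatest final factor of `(K → C)γ` for a positive path `γ` from `C` to `D`, computed along
the path `γ`. -/
noncomputable def lastFactorPath (hL : A.StrongLattice) :
    {C D : A.Chamber} → A.PosPath C D → A.Chamber → A.Chamber
  | _, _, .nil, K => K
  | C, _, .cons (v := E) _ p, K => hL.lastFactorPath p (hL.lastFactor K C E)

theorem lastFactorPath_append (hL : A.StrongLattice) {C D E : A.Chamber} (p : A.PosPath C D)
    (q : A.PosPath D E) (K : A.Chamber) :
    hL.lastFactorPath (p.append q) K = hL.lastFactorPath q (hL.lastFactorPath p K) := by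
  induction p generalizing K with
  | nil => rfl
  | cons h p ih =>
    rw [SimpleGraph.Walk.cons_append, lastFactorPath, lastFactorPath, ih]

theorem lastFactorPath_of_isMinimal (hL : A.StrongLattice) {C D : A.Chamber} {p : A.PosPath C D}
    (hp : p.IsMinimal) (K : A.Chamber) : hL.lastFactorPath p K = hL.lastFactor K C D := by
  induction p generalizing K with
  | nil => rw [lastFactorPath, hL.lastFactor_self]
  | cons h p ih =>
    rw [lastFactorPath, ih hp.of_cons, hL.lastFactor_lastFactor hp.disjoint_of_cons]

theorem lastFactorPath_congr (hL : A.StrongLattice) {C D : A.Chamber} {p q : A.PosPath C D}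
    (h : p.Equiv q) (K : A.Chamber) : hL.lastFactorPath p K = hL.lastFactorPath q K := by
  induction h generalizing K with
  | minimal p q hp hq =>
    rw [hL.lastFactorPath_of_isMinimal hp, hL.lastFactorPath_of_isMinimal hq]
  | refl p => rfl
  | symm _ ih => exact (ih K).symm
  | trans _ _ ih₁ ih₂ => exact (ih₁ K).trans (ih₂ K)
  | append _ _ ih₁ ih₂ => rw [lastFactorPath_append, lastFactorPath_append, ih₁, ih₂]

end StrongLattice

/-- A final factor of a final factor is a final factor. -/
theorem PosPath.EndsWith.mono {B C K E : A.Chamber} {γ : A.PosPath B C} (h : γ.EndsWith K)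
    (hE : A.sep C E ⊆ A.sep C K) : γ.EndsWith E := by
  obtain ⟨γ', μ, hμ, hγ⟩ := h
  obtain ⟨p, hp⟩ := exists_isMinimal K E
  obtain ⟨q, hq⟩ := exists_isMinimal E C
  have hdisj : Disjoint (A.sep K E) (A.sep E C) := by
    rw [A.sep_comm K E, A.sep_comm E C]
    exact (disjoint_sep_of_subset hE).symm
  refine ⟨γ'.append p, q, hq, hγ.trans ?_⟩
  rw [← SimpleGraph.Walk.append_assoc]
  exact .append (.refl _) (.minimal _ _ hμ (hp.append hq hdisj))

/-- If `γ` ends with `(K → D)`, then `γ(D → C)` ends with `(E → C)`, where `E` is the greatest final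
factor of `(K → D)(D → C)`. -/
theorem PosPath.EndsWith.append_lastFactor (hL : A.StrongLattice) {B C D K : A.Chamber}
    {γ : A.PosPath B D} (h : γ.EndsWith K) {p : A.PosPath D C} (hp : p.IsMinimal) :
    PosPath.EndsWith (SimpleGraph.Walk.append γ p) (hL.lastFactor K D C) := by
  obtain ⟨hK, hdisj⟩ := hL.subset_sep_lastFactor_iff.1
    (subset_refl (A.sep D (hL.lastFactor K D C)))
  obtain ⟨γ', μ, hμ, hγ⟩ := h.mono hK
  refine ⟨γ', SimpleGraph.Walk.append μ p, hμ.append hp ?_, ?_⟩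
  · rwa [A.sep_comm _ D]
  · rw [SimpleGraph.Walk.append_assoc]
    exact .append hγ (.refl _)

theorem PosPath.EndsWith.append_lastFactorPath (hL : A.StrongLattice) {B C D K : A.Chamber}
    {γ : A.PosPath B D} (h : γ.EndsWith K) (p : A.PosPath D C) :
    PosPath.EndsWith (SimpleGraph.Walk.append γ p) (hL.lastFactorPath p K) := by
  induction p generalizing K with
  | nil => rwa [SimpleGraph.Walk.append_nil]
  | cons e p ih =>
    have := ih (h.append_lastFactor hL (PosPath.isMinimal_of_adj e))
    rwa [← SimpleGraph.Walk.append_assoc] at this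

theorem StrongLattice.propertyD (hL : A.StrongLattice) : A.PropertyD := by
  intro B C γ
  refine ⟨hL.lastFactorPath γ B, fun (E : A.Chamber) => ⟨?_, fun h => ?_⟩⟩
  · rintro ⟨γ', μ, hμ, hγ⟩
    have h1 := hL.lastFactorPath_congr hγ B
    rw [hL.lastFactorPath_append, hL.lastFactorPath_of_isMinimal hμ] at h1
    change A.sep C E ⊆ A.sep C (hL.lastFactorPath γ B)
    rw [h1, hL.sep_lastFactor]
    exact Set.subset_union_left
  · have hnil : PosPath.EndsWith (SimpleGraph.Walk.nil : A.PosPath B B) B :=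
      ⟨.nil, .nil, fun q => Nat.zero_le _, .refl _⟩
    exact (hnil.append_lastFactorPath hL γ).mono h

/-! ### Property D implies the strong lattice property -/

/-- The chamber that property D assigns to the path `(X → B)(B → C)`, where `C` is opposite to `Y`,
is the meet of `X` and `Y`. -/
theorem PropertyD.exists_isMeet (hD : A.PropertyD) (B X Y : A.Chamber) :
    ∃ M, IsMeet B X Y M := by
  classical
  obtain ⟨p, hp⟩ := exists_isMinimal X B
  obtain ⟨q, hq⟩ := exists_isMinimal B (opposite Y)
  obtain ⟨(K : A.Chamber), hK⟩ := hD X (opposite Y) (p.append q)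
  have hK' : ∀ E : A.Chamber, PosPath.EndsWith (p.append q) E ↔
      A.sep (opposite Y) E ⊆ A.sep (opposite Y) K := hK
  have hBK : A.sep (opposite Y) B ⊆ A.sep (opposite Y) K := (hK' B).1 ⟨p, q, hq, .refl _⟩
  have hdisj := disjoint_sep_of_subset hBK
  refine ⟨K, fun H hH => ?_, fun H hH => ?_, fun U hX hY => ?_⟩
  · obtain ⟨γ, μ, hμ, hγ⟩ := (hK' K).2 subset_rfl
    -- Compare the numbers of crossings of `H` on both sides of `(X → B)(B → C) ∼ γ(K → C)`.
    have h1 := hγ.crossings_eq hH.1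
    have h2 : H ∉ A.sep B (opposite Y) := by
      rw [A.sep_comm]
      exact Set.disjoint_right.1 hdisj hH
    have h3 : H ∈ A.sep K (opposite Y) := by
      rw [A.sep_comm, sep_eq_union hdisj]
      exact Or.inr hH
    rw [PosPath.crossings_append, PosPath.crossings_append, hp.crossings_eq hH.1,
      hq.crossings_eq hH.1, hμ.crossings_eq hH.1, if_neg h2, if_pos h3] at h1
    by_contra h4
    rw [A.sep_comm] at h4
    rw [if_neg h4] at h1
    omega
  · have h2 : H ∉ A.sep B (opposite Y) := by
      rw [A.sep_comm]
      exact Set.disjoint_right.1 hdisj hH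
    by_contra h3
    exact h2 ((mem_sep_opposite B Y).2 ⟨hH.1, h3⟩)
  · have hend : PosPath.EndsWith p U := by
      refine PosPath.EndsWith.mono ⟨.nil, p, hp, ?_⟩ hX
      exact .refl _
    obtain ⟨γ, μ, hμ, hγ⟩ := hend
    have hUY : Disjoint (A.sep U B) (A.sep B (opposite Y)) := by
      rw [A.sep_comm U B, Set.disjoint_left]
      exact fun H hH h => ((mem_sep_opposite B Y).1 h).2 (hY hH)
    have hU := (hK' U).1 ⟨γ, SimpleGraph.Walk.append μ q, hμ.append hq hUY, by
      rw [SimpleGraph.Walk.append_assoc]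
      exact .append hγ (.refl _)⟩
    rw [sep_eq_union hdisj, sep_eq_union (D := B) (E := U)
      (by rw [A.sep_comm (opposite Y) B, A.sep_comm B U]; exact hUY.symm), Set.union_subset_iff] at hU
    refine Disjoint.subset_right_of_subset_union hU.2 ?_
    rwa [A.sep_comm B U, A.sep_comm (opposite Y) B]

theorem PropertyD.strongLattice (hD : A.PropertyD) : A.StrongLattice :=
  strongLattice_of_exists_isMeet hD.exists_isMeet

end RealArrangement

theorem mainTheorem1 {d : ℕ} (A : RealArrangement d) :
    (A.PropertyD → A.StrongLattice ∧ A.Simplicial) ∧ (A.PropertyD ↔ A.Simplicial) :=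
  ⟨fun h => ⟨h.strongLattice, h.strongLattice.simplicial⟩,
    fun h => h.strongLattice.simplicial, fun h => h.strongLattice.propertyD⟩
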